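/- Setting. A function on the torus $\mathbb T^m=(\mathbb R/2\pi\mathbb Z)^m$ is piecewise smooth if there are at most countably many pairwise disjoint open sets covering the torus up to a null set, on each of which it is smooth. Real numbers $x_1,\dots,x_r$ are rationally independent if $\sum_j n_jx_j=0$ with $n\in\mathbb Z^r$ only for $n=0$. Let $\omega=(\omega_1,\dots,\omega_m)$ be rationally independent, and let $H(t)$ be a Hermitian $2\times2$ matrix (a single-qubit Hamiltonian), locally integrable in $t\in\mathbb R$, that is quasiperiodic with frequency vector $\omega$: $H(t)=\hat H(\omega t)$ for a piecewise smooth matrix-valued function $\hat H$ on $\mathbb T^m$. Let $U(t)$, $t\ge 0$, be its evolution operator, $U(t)=\mathbb 1-i\int_0^tH(s)U(s)\,ds$. All integrals against $dV$ are with respect to the Haar probability measure on $\mathrm U(2)$, and $\varphi_0=|0\rangle\langle 0|$. Since adding a (time-dependent) multiple of the identity to $H$ only changes the global phase of $U$, quasienergies are taken with respect to the traceless part $H_0(t)=H(t)-\tfrac12\operatorname{tr}(H(t))\,\mathbb 1$ (so $H_0=H$ if $H$ is traceless): a quasienergy eigenstate with quasienergy $q\in\mathbb R$ is a piecewise smooth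 family of unit vectors $|\alpha(\theta)\rangle\in\mathbb C^2$, $\theta\in\mathbb T^m$, such that $|\psi(t)\rangle=e^{-iqt}|\alpha(\omega t)\rangle$ is a continuous solution of $|\psi(t)\rangle=|\psi(0)\rangle-i\int_0^tH_0(s)|\psi(s)\rangle\,ds$ for $t\ge0$. Write $\alpha(\theta)=|\alpha(\theta)\rangle\langle\alpha(\theta)|$. Theorem. Suppose that $H$ has a quasienergy eigenstate $|\alpha(\theta)\rangle$ whose quasienergy $q$ is rationally independent of the driving frequencies, i.e. $q,\omega_1,\dots,\omega_m$ are rationally independent. Then the evolution operator exists, and the following hold. (1) For every $k\in\mathbb N$: if $\alpha$ satisfies the $k$-HSE condition $$\frac1{(2\pi)^m}\int_{\mathbb T^m}\alpha(\theta)^{\otimes k}\,d\theta=\int (V\varphi_0V^\dagger)^{\otimes k}\,dV,$$ then $H$ satisfies $k$-UE: $$\lim_{T\to\infty}\frac1T\int_0^T\big(U(t)^*\otimes U(t)\big)^{\otimes k}dt=\int (V^*\otimes V)^{\otimes k}\,dV,$$ where $^*$ is the entrywise complex conjugate. (2) If $\alpha$ satisfies the CHSE condition, i.e. $\alpha(\theta)$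 for uniformly distributed $\theta\in\mathbb T^m$ has the same distribution as $V\varphi_0V^\dagger$ for Haar-random $V$, then $H$ satisfies CUE: the probability measures $\frac1T\int_0^T\delta_{U(t)^*\otimes U(t)}\,dt$ converge weakly, as $T\to\infty$, to the distribution of $V^*\otimes V$ for Haar-random $V$. -/

import Mathlib

open MeasureTheory Filter Topology
open scoped Kronecker

noncomputable section

namespace QubitErgodicity

/-! ### Haar measure on `U(2)` -/

/-- The unitary group `U(2)`. -/
abbrev U2 : Type := Matrix.unitaryGroup (Fin 2) ℂ

instance instMeasurableSpaceU2 : MeasurableSpace U2 := borel U2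

instance instBorelSpaceU2 : BorelSpace U2 := ⟨rfl⟩

instance instCompactSpaceU2 : CompactSpace U2 := by
  have hbox : IsCompact (Set.univ.pi fun _ : Fin 2 => Set.univ.pi fun _ : Fin 2 =>
      Metric.closedBall (0 : ℂ) 1) :=
    isCompact_univ_pi fun _ => isCompact_univ_pi fun _ => isCompact_closedBall 0 1
  have hclosed : IsClosed ((Matrix.unitaryGroup (Fin 2) ℂ : Set (Matrix (Fin 2) (Fin 2) ℂ))) :=
    isClosed_unitary
  refine isCompact_iff_compactSpace.mp (hbox.of_isClosed_subset hclosed ?_)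
  intro V hV i _ j _
  simpa using entry_norm_bound_of_unitary hV i j

/-- The Haar probability measure on `U(2)` (total mass `1`). -/
def haarU2 : Measure U2 := Measure.haarMeasure ⊤

/-! ### States, channels, tensor powers -/

/-- The density matrix `|v⟩⟨v|`. -/
def projector (v : Fin 2 → ℂ) : Matrix (Fin 2) (Fin 2) ℂ := Matrix.vecMulVec v (star v)

/-- The fixed reference state `φ₀ = |0⟩⟨0|`. -/
def refState : Matrix (Fin 2) (Fin 2) ℂ := projector (Pi.single 0 1)

/-- The `k`-th tensor power `A^{⊗k}`, as a matrix indexed by `k`-tuples of indices. -/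
def tensorPower {n : Type*} (k : ℕ) (A : Matrix n n ℂ) : Matrix (Fin k → n) (Fin k → n) ℂ :=
  Matrix.of fun i j => ∏ l, A (i l) (j l)

/-- The vectorized unitary channel `V^* ⊗ V`, where `V^*` is the entrywise complex conjugate. -/
def channel (V : Matrix (Fin 2) (Fin 2) ℂ) : Matrix (Fin 2 × Fin 2) (Fin 2 × Fin 2) ℂ :=
  V.map star ⊗ₖ V

/-- `ρ_Haar^{(k)} = ∫ (U φ₀ U†)^{⊗k} dU`. -/
def haarStateMoment (k : ℕ) : Matrix (Fin k → Fin 2) (Fin k → Fin 2) ℂ :=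
  Matrix.of fun i j =>
    ∫ V : U2, tensorPower k (V.1 * refState * V.1.conjTranspose) i j ∂haarU2

/-- `E_{V ∼ Haar} [(V^* ⊗ V)^{⊗k}]`. -/
def haarUnitaryMoment (k : ℕ) :
    Matrix (Fin k → Fin 2 × Fin 2) (Fin k → Fin 2 × Fin 2) ℂ :=
  Matrix.of fun i j => ∫ V : U2, tensorPower k (channel V.1) i j ∂haarU2

/-! ### Functions on the torus `(ℝ / 2πℤ)^m`, as `2π`-periodic functions of `m` real angles -/

/-- `F` is `2π`-periodic in each angle, i.e. it is a function on the torus. -/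
def TorusPeriodic {m : ℕ} {E : Type*} (F : (Fin m → ℝ) → E) : Prop :=
  ∀ (θ : Fin m → ℝ) (n : Fin m → ℤ), F (fun j => θ j + 2 * Real.pi * n j) = F θ

/-- Piecewise smoothness with at most countably many pieces: the pieces are pairwise disjoint open
sets which cover everything up to a (closed) null set, and `f` is smooth on each piece.
Pieces may be empty, so finitely many pieces are allowed. -/
def PiecewiseSmooth {m : ℕ} (f : (Fin m → ℝ) → ℂ) : Prop :=
  ∃ P : ℕ → Set (Fin m → ℝ), (∀ i, IsOpen (P i)) ∧ Pairwise (fun i j => Disjoint (P i) (P j)) ∧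
    volume (⋃ i, P i)ᶜ = 0 ∧ ∀ i, ContDiffOn ℝ ((⊤ : ℕ∞) : WithTop ℕ∞) f (P i)

/-- The average of `f` over the torus, `(2π)^{-m} ∫_{[0,2π)^m} f(θ) dθ`. -/
def torusAverage {m : ℕ} (f : (Fin m → ℝ) → ℂ) : ℂ :=
  (((2 * Real.pi) ^ m : ℝ) : ℂ)⁻¹ *
    ∫ θ in Set.univ.pi (fun _ : Fin m => Set.Ico (0 : ℝ) (2 * Real.pi)), f θ

/-- Real numbers `ω_i` are rationally independent: `∑ n_i ω_i = 0` with integers `n_i` only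
for `n = 0`. -/
def RationallyIndependent {m : ℕ} (ω : Fin m → ℝ) : Prop :=
  ∀ n : Fin m → ℤ, ∑ j, (n j : ℝ) * ω j = 0 → n = 0

/-! ### Quasiperiodic Hamiltonians and their dynamics -/

/-- `H` is a single-qubit Hamiltonian which is quasiperiodic with frequency vector `ω`:
`H(t) = Ĥ(ω t)` for a piecewise smooth parent Hamiltonian `Ĥ` on the torus, with
rationally independent frequencies. Local integrability makes the time-ordered exponential
meaningful. -/
structure IsQuasiperiodicHamiltonian {m : ℕ} (ω : Fin m → ℝ)
    (H : ℝ → Matrix (Fin 2) (Fin 2) ℂ) : Prop where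
  isHermitian : ∀ t, (H t).IsHermitian
  locallyIntegrable : ∀ i j, LocallyIntegrable (fun t => H t i j)
  rationallyIndependent : RationallyIndependent ω
  parent : ∃ Hhat : (Fin m → ℝ) → Matrix (Fin 2) (Fin 2) ℂ, TorusPeriodic Hhat ∧
    (∀ i j, PiecewiseSmooth fun θ => Hhat θ i j) ∧ ∀ t : ℝ, H t = Hhat (t • ω)

/-- `ψ` solves the Schrödinger equation `i ψ' = H ψ` for times `t ≥ 0`. As `H` may be
discontinuous in time, the equation is meant in its integrated form
`ψ(t) = ψ(0) - i ∫₀ᵗ H(s) ψ(s) ds`. -/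
def IsSchrodingerSolution (H : ℝ → Matrix (Fin 2) (Fin 2) ℂ) (ψ : ℝ → Fin 2 → ℂ) : Prop :=
  ContinuousOn ψ (Set.Ici 0) ∧
    ∀ t, 0 ≤ t → ψ t = ψ 0 - Complex.I • ∫ s in (0 : ℝ)..t, (H s).mulVec (ψ s)

/-- `U(t)` is the evolution operator `T exp(-i ∫₀ᵗ H)`, for `t ≥ 0`: it starts at the identity and
propagates every initial state along the Schrödinger equation. -/
def IsEvolutionOperator (H U : ℝ → Matrix (Fin 2) (Fin 2) ℂ) : Prop :=
  U 0 = 1 ∧ ∀ v : Fin 2 → ℂ, IsSchrodingerSolution H fun t => (U t).mulVec v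

/-- The traceless part `H(t) - (tr H(t) / 2) 1`. It generates the same unitary channels as `H`:
the two evolution operators differ by a global phase. -/
def tracelessPart (H : ℝ → Matrix (Fin 2) (Fin 2) ℂ) : ℝ → Matrix (Fin 2) (Fin 2) ℂ :=
  fun t => H t - ((H t).trace / 2) • (1 : Matrix (Fin 2) (Fin 2) ℂ)

/-- `α` is a quasienergy eigenstate of `H` (driven at frequencies `ω`) with quasienergy `q`: a
piecewise smooth family of unit vectors on the torus such that `e^{-iqt} |α(ω t)⟩` solves the
Schrödinger equation. -/
structure IsQuasienergyEigenstate {m : ℕ} (ω : Fin m → ℝ) (H : ℝ → Matrix (Fin 2) (Fin 2) ℂ)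
    (q : ℝ) (α : (Fin m → ℝ) → Fin 2 → ℂ) : Prop where
  periodic : TorusPeriodic α
  normalized : ∀ θ, star (α θ) ⬝ᵥ α θ = 1
  piecewiseSmooth : ∀ i, PiecewiseSmooth fun θ => α θ i
  solution : IsSchrodingerSolution H
    fun t => Complex.exp (-(Complex.I * (q : ℂ) * (t : ℂ))) • α (t • ω)

/-! ### Ergodicity conditions -/

/-- The `k`-HSE condition on a state-valued function on the torus:
`E_θ [α(θ)^{⊗k}] = ρ_Haar^{(k)}`. -/
def TorusKHSE {m : ℕ} (k : ℕ) (α : (Fin m → ℝ) → Fin 2 → ℂ) : Prop :=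
  (Matrix.of fun i j => torusAverage fun θ => tensorPower k (projector (α θ)) i j) =
    haarStateMoment k

/-- The CHSE condition on a state-valued function on the torus: for uniformly distributed `θ`, the
state `|α(θ)⟩⟨α(θ)|` has the distribution of a Haar-random pure state (equality of
distributions tested on all continuous functions). -/
def TorusCHSE {m : ℕ} (α : (Fin m → ℝ) → Fin 2 → ℂ) : Prop :=
  ∀ f : Matrix (Fin 2) (Fin 2) ℂ → ℂ, Continuous f →
    torusAverage (fun θ => f (projector (α θ))) =
      ∫ V : U2, f (V.1 * refState * V.1.conjTranspose) ∂haarU2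

/-- The finite-time average `(1/T) ∫₀ᵀ f(t) dt`. -/
def timeAverage (f : ℝ → ℂ) (T : ℝ) : ℂ := (T : ℂ)⁻¹ * ∫ t in (0 : ℝ)..T, f t

/-- `k`-UE of an evolution: the infinite-time average of `(U(t)^* ⊗ U(t))^{⊗k}` exists and equals
`E_{V ∼ Haar} [(V^* ⊗ V)^{⊗k}]`. -/
def EvolutionKUE (k : ℕ) (U : ℝ → Matrix (Fin 2) (Fin 2) ℂ) : Prop :=
  Tendsto
    (fun T : ℝ => Matrix.of fun i j => timeAverage (fun t => tensorPower k (channel (U t)) i j) T)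
    atTop (𝓝 (haarUnitaryMoment k))

/-- CUE of an evolution: the temporal ensemble of the channels `U(t)^* ⊗ U(t)` has a limiting
distribution (in the sense of weak convergence), and it is that of `V^* ⊗ V` for Haar-random
`V`. -/
def EvolutionCUE (U : ℝ → Matrix (Fin 2) (Fin 2) ℂ) : Prop :=
  ∀ f : Matrix (Fin 2 × Fin 2) (Fin 2 × Fin 2) ℂ → ℂ, Continuous f →
    Tendsto (timeAverage fun t => f (channel (U t))) atTop
      (𝓝 (∫ V : U2, f (channel V.1) ∂haarU2))

/-- `H` satisfies `k`-UE: its evolution operator exists and satisfies `k`-UE. -/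
def SatisfiesKUE (k : ℕ) (H : ℝ → Matrix (Fin 2) (Fin 2) ℂ) : Prop :=
  (∃ U, IsEvolutionOperator H U) ∧ ∀ U, IsEvolutionOperator H U → EvolutionKUE k U

/-- `H` satisfies CUE: its evolution operator exists and satisfies CUE. -/
def SatisfiesCUE (H : ℝ → Matrix (Fin 2) (Fin 2) ℂ) : Prop :=
  (∃ U, IsEvolutionOperator H U) ∧ ∀ U, IsEvolutionOperator H U → EvolutionCUE U

end QubitErgodicity

end

/-! A traceless qubit Hamiltonian is compatible with antiunitary time reversal, so one solution
brings an orthogonal one with it (`IsSchrodingerSolution.spinFlip`). The eigenstate alone therefore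
determines the evolution: up to a global phase, which the channel does not see, U(t) = W(ωt)
diag(e^{-iqt}, e^{iqt}) W(0)† with W = `frame ∘ α`.

In the k-th tensor power of the channel, the constant factor W(0)† is absorbed by right invariance
of Haar measure. The diagonal factor multiplies column l by e^{icqt}, where c = `tensorCharge l`. By
Weyl equidistribution twisted by this character (`tendsto_timeAverage_torus`), independence of q
from ω makes the time average vanish for c ≠ 0 and turns it into a torus average for c = 0. The Haar
moment also vanishes in columns with c ≠ 0 (`haarUnitaryMoment_apply_eq_zero`). For c = 0,
conjugated and unconjugated factors can be paired within the same column of V, and the second column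
is eliminated by unitarity. This expresses the entry linearly in the k-th state moment
(`exists_coeff_tensorPower_channel`), where k-HSE applies.

CHSE gives k-HSE for every k. Matrix entries of all tensor powers span a dense subspace of the
continuous functions on the compact set of unitary channels by Stone–Weierstrass, so convergence of
all moments gives CUE.

Two points need analysis: the Hamiltonian is only locally integrable, so derivatives exist almost
everywhere and are handled by absolute continuity; and the eigenstate is only continuous off a
closed null set, so Weyl's theorem is extended by a cutoff. -/

noncomputable section

namespace QubitErgodicity

/-! ### Primitives of locally integrable functions on the half line -/

/-- On `[0, ∞)`, `F` is a primitive of the locally integrable function `f`. -/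
structure IsPrimitive (F f : ℝ → ℂ) : Prop where
  intervalIntegrable : ∀ t, 0 ≤ t → IntervalIntegrable f volume 0 t
  eq_integral : ∀ t, 0 ≤ t → F t = F 0 + ∫ s in (0 : ℝ)..t, f s

lemma _root_.LipschitzWith.comp_absolutelyContinuousOnInterval {X Y : Type*} [PseudoMetricSpace X]
    [PseudoMetricSpace Y] {φ : X → Y} {K : NNReal} (hφ : LipschitzWith K φ) {f : ℝ → X} {a b : ℝ}
    (hf : AbsolutelyContinuousOnInterval f a b) :
    AbsolutelyContinuousOnInterval (fun x => φ (f x)) a b := by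
  unfold AbsolutelyContinuousOnInterval at hf ⊢
  refine squeeze_zero (fun E => Finset.sum_nonneg fun _ _ => dist_nonneg) (fun E => ?_)
    (by simpa using hf.const_mul (K : ℝ))
  rw [Finset.mul_sum]
  exact Finset.sum_le_sum fun i _ => hφ.dist_le_mul _ _

lemma _root_.IntervalIntegrable.absolutelyContinuousOnInterval_integral_complex {f : ℝ → ℂ}
    {a b : ℝ} (hf : IntervalIntegrable f volume a b) :
    AbsolutelyContinuousOnInterval (fun t => ∫ s in a..t, f s) a b := by
  have hre : IntervalIntegrable (fun s => (f s).re) volume a b := ⟨hf.1.re, hf.2.re⟩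
  have him : IntervalIntegrable (fun s => (f s).im) volume a b := ⟨hf.1.im, hf.2.im⟩
  have h1 := (hre.absolutelyContinuousOnInterval_intervalIntegral
    (Set.left_mem_uIcc)).smul (f := fun t => (∫ s in a..t, (f s).re)) (g := fun _ => (1 : ℂ))
    (LipschitzOnWith.absolutelyContinuousOnInterval
      ((LipschitzWith.const (1 : ℂ)).lipschitzOnWith))
  have h2 := (him.absolutelyContinuousOnInterval_intervalIntegral
    (Set.left_mem_uIcc)).smul (f := fun t => (∫ s in a..t, (f s).im)) (g := fun _ => Complex.I)
    (LipschitzOnWith.absolutelyContinuousOnInterval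
      ((LipschitzWith.const Complex.I).lipschitzOnWith))
  have h := h1.add h2
  refine ((absolutelyContinuousOnInterval_iff _ _ _).2 ?_)
  intro ε hε
  obtain ⟨δ, hδ, H⟩ := (absolutelyContinuousOnInterval_iff _ _ _).1 h ε hε
  refine ⟨δ, hδ, fun E hE hlt => (Finset.sum_congr rfl fun i hi => ?_).trans_lt (H E hE hlt)⟩
  have key : ∀ t ∈ Set.uIcc a b, ∫ s in a..t, f s =
      ((fun t => ∫ s in a..t, (f s).re) • (fun _ => (1 : ℂ)) +
        (fun t => ∫ s in a..t, (f s).im) • fun _ => Complex.I : ℝ → ℂ) t := by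
    intro t ht
    have hft : IntervalIntegrable f volume a t := hf.mono_set (Set.uIcc_subset_uIcc_left ht)
    have e1 := Complex.reCLM.intervalIntegral_comp_comm hft
    have e2 := Complex.imCLM.intervalIntegral_comp_comm hft
    simp only [Complex.reCLM_apply, Complex.imCLM_apply] at e1 e2
    simp only [Pi.add_apply, Pi.smul_apply', e1, e2]
    apply Complex.ext <;> simp
  have hE' := hE.1 i (Finset.mem_range.1 hi |> fun h => Finset.mem_range.2 h)
  rw [key _ hE'.1, key _ hE'.2]

/-- Subtracting the integral of `f` from `F` leaves an absolutely continuous function with zero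
derivative almost everywhere, hence a constant. -/
lemma integral_eq_sub_of_ae_hasDerivAt {F f : ℝ → ℂ} {a b : ℝ}
    (hF : AbsolutelyContinuousOnInterval F a b) (hf : IntervalIntegrable f volume a b)
    (hd : ∀ᵐ x, x ∈ Set.uIcc a b → HasDerivAt F (f x) x) :
    ∫ s in a..b, f s = F b - F a := by
  have h := hF.sub hf.absolutelyContinuousOnInterval_integral_complex
  obtain ⟨C, hC⟩ := h.const_of_ae_hasDerivAt_zero (by
    filter_upwards [hd, hf.ae_hasDerivAt_integral] with x h1 h2 hx
    simpa using (h1 hx).sub (h2 hx a Set.left_mem_uIcc))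
  have e1 := hC a Set.left_mem_uIcc
  have e2 := hC b Set.right_mem_uIcc
  simp only [Pi.sub_apply, intervalIntegral.integral_same, sub_zero] at e1 e2
  rw [e1, ← e2]; ring

namespace IsPrimitive

variable {F f G g : ℝ → ℂ}

lemma congr (h : IsPrimitive F f) (hF : ∀ t, 0 ≤ t → F t = G t) (hf : ∀ t, 0 ≤ t → f t = g t) :
    IsPrimitive G g where
  intervalIntegrable t ht := (h.intervalIntegrable t ht).congr (by
    rw [Set.uIoc_of_le ht]
    exact fun s hs => hf s hs.1.le)
  eq_integral t ht := by
    rw [← hF t ht, ← hF 0 le_rfl, h.eq_integral t ht]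
    congr 1
    refine intervalIntegral.integral_congr fun s hs => hf s ?_
    rw [Set.uIcc_of_le ht] at hs
    exact hs.1

lemma absolutelyContinuous (h : IsPrimitive F f) {t : ℝ} (ht : 0 ≤ t) :
    AbsolutelyContinuousOnInterval F 0 t := by
  have h1 := (LipschitzOnWith.absolutelyContinuousOnInterval (a := 0) (b := t)
    ((LipschitzWith.const (F 0)).lipschitzOnWith)).add
    (h.intervalIntegrable t ht).absolutelyContinuousOnInterval_integral_complex
  rw [absolutelyContinuousOnInterval_iff] at h1 ⊢
  intro ε hε
  obtain ⟨δ, hδ, H⟩ := h1 ε hε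
  refine ⟨δ, hδ, fun E hE hlt => (Finset.sum_congr rfl fun i hi => ?_).trans_lt (H E hE hlt)⟩
  have hE' := hE.1 i hi
  rw [Set.uIcc_of_le ht] at hE'
  rw [h.eq_integral _ hE'.1.1, h.eq_integral _ hE'.2.1]
  rfl

lemma ae_hasDerivAt (h : IsPrimitive F f) {t : ℝ} (ht : 0 ≤ t) :
    ∀ᵐ x, x ∈ Set.uIcc 0 t → HasDerivAt F (f x) x := by
  -- The integral formula holds only for nonnegative times, so it gives no two-sided neighbourhood
  -- of 0.
  have h0 : ∀ᵐ x : ℝ, x ≠ 0 := by simp [ae_iff]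
  filter_upwards [(h.intervalIntegrable t ht).ae_hasDerivAt_integral, h0] with x hx hx0 hxt
  rw [Set.uIcc_of_le ht] at hxt
  refine ((hx (by rwa [Set.uIcc_of_le ht]) 0 Set.left_mem_uIcc).const_add (F 0)).congr_of_eventuallyEq
    ?_
  filter_upwards [Ioi_mem_nhds (lt_of_le_of_ne hxt.1 hx0.symm)] with y hy
  exact h.eq_integral y (le_of_lt hy)

lemma continuousOn (h : IsPrimitive F f) : ContinuousOn F (Set.Ici 0) := by
  intro x hx
  have h1 := (h.absolutelyContinuous (t := x + 1) (by
    have : (0 : ℝ) ≤ x := hx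
    linarith)).continuousOn
  have hx' : (0 : ℝ) ≤ x := hx
  rw [Set.uIcc_of_le (by linarith)] at h1
  refine (h1 x ⟨hx, by linarith⟩).mono_of_mem_nhdsWithin ?_
  rw [mem_nhdsWithin]
  exact ⟨Set.Iio (x + 1), isOpen_Iio, by simp, fun y hy => ⟨hy.2, le_of_lt hy.1⟩⟩

/-- Product rule: products of absolutely continuous functions are absolutely continuous, and the
pointwise rule holds almost everywhere. -/
lemma mul (hF : IsPrimitive F f) (hG : IsPrimitive G g) :
    IsPrimitive (fun t => F t * G t) (fun t => f t * G t + F t * g t) := by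
  have hi : ∀ t, 0 ≤ t → IntervalIntegrable (fun t => f t * G t + F t * g t) volume 0 t := by
    intro t ht
    exact ((hF.intervalIntegrable t ht).mul_continuousOn
      (hG.absolutelyContinuous ht).continuousOn).add
      ((hG.intervalIntegrable t ht).continuousOn_mul (hF.absolutelyContinuous ht).continuousOn)
  refine ⟨hi, fun t ht => ?_⟩
  rw [integral_eq_sub_of_ae_hasDerivAt
    ((hF.absolutelyContinuous ht).smul (hG.absolutelyContinuous ht)) (hi t ht)]
  · simp
  · filter_upwards [hF.ae_hasDerivAt ht, hG.ae_hasDerivAt ht] with x h1 h2 hx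
    exact (h1 hx).mul (h2 hx)

lemma add (hF : IsPrimitive F f) (hG : IsPrimitive G g) :
    IsPrimitive (fun t => F t + G t) (fun t => f t + g t) where
  intervalIntegrable t ht := (hF.intervalIntegrable t ht).add (hG.intervalIntegrable t ht)
  eq_integral t ht := by
    rw [intervalIntegral.integral_add (hF.intervalIntegrable t ht) (hG.intervalIntegrable t ht),
      hF.eq_integral t ht, hG.eq_integral t ht]
    ring

lemma const_mul (c : ℂ) (hF : IsPrimitive F f) :
    IsPrimitive (fun t => c * F t) (fun t => c * f t) where
  intervalIntegrable t ht := (hF.intervalIntegrable t ht).const_mul c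
  eq_integral t ht := by
    rw [intervalIntegral.integral_const_mul, hF.eq_integral t ht]
    ring

lemma star (hF : IsPrimitive F f) : IsPrimitive (fun t => star (F t)) (fun t => star (f t)) where
  intervalIntegrable t ht := by
    have := hF.intervalIntegrable t ht
    exact ⟨Complex.conjLIE.toContinuousLinearEquiv.toContinuousLinearMap.integrable_comp this.1,
      Complex.conjLIE.toContinuousLinearEquiv.toContinuousLinearMap.integrable_comp this.2⟩
  eq_integral t ht := by
    have := Complex.conjLIE.toContinuousLinearEquiv.toContinuousLinearMap.intervalIntegral_comp_comm
      (hF.intervalIntegrable t ht)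
    change ∫ s in (0 : ℝ)..t, Star.star (f s) = Star.star (∫ s in (0 : ℝ)..t, f s) at this
    rw [this, hF.eq_integral t ht, star_add]

lemma eq_of_zero (hF : IsPrimitive F fun _ => 0) {t : ℝ} (ht : 0 ≤ t) : F t = F 0 := by
  simpa using hF.eq_integral t ht

end IsPrimitive

/-- The map x ↦ e^{ix} is 1-Lipschitz, so it preserves absolute continuity; the chain rule then
applies almost everywhere. -/
lemma isPrimitive_exp {h : ℝ → ℝ} (hh : LocallyIntegrable h) :
    IsPrimitive (fun t => Complex.exp (((∫ s in (0 : ℝ)..t, h s : ℝ) : ℂ) * Complex.I))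
      (fun t => Complex.I * (h t : ℂ) *
        Complex.exp (((∫ s in (0 : ℝ)..t, h s : ℝ) : ℂ) * Complex.I)) := by
  have hI : ∀ a b, IntervalIntegrable h volume a b := fun a b =>
    (hh.integrableOn_isCompact isCompact_uIcc).intervalIntegrable
  have hE : LipschitzWith 1 fun x : ℝ => Complex.exp ((x : ℂ) * Complex.I) := by
    refine lipschitzWith_of_nnnorm_deriv_le (𝕜 := ℝ) ?_ ?_
    · fun_prop
    · intro x
      have h1 : HasDerivAt (fun x : ℝ => Complex.exp ((x : ℂ) * Complex.I))
          (Complex.exp ((x : ℂ) * Complex.I) * (1 * Complex.I)) x :=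
        ((Complex.ofRealCLM.hasDerivAt (x := x)).mul_const Complex.I).cexp
      rw [h1.deriv, ← NNReal.coe_le_coe]
      simp
  have hac : ∀ t, AbsolutelyContinuousOnInterval
      (fun t => Complex.exp (((∫ s in (0 : ℝ)..t, h s : ℝ) : ℂ) * Complex.I)) 0 t := fun t =>
    hE.comp_absolutelyContinuousOnInterval
      ((hI 0 t).absolutelyContinuousOnInterval_intervalIntegral Set.left_mem_uIcc)
  have hi : ∀ t, IntervalIntegrable (fun t => Complex.I * (h t : ℂ) *
        Complex.exp (((∫ s in (0 : ℝ)..t, h s : ℝ) : ℂ) * Complex.I)) volume 0 t := by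
    intro t
    refine IntervalIntegrable.mul_continuousOn ?_ (hac t).continuousOn
    have : IntervalIntegrable (fun s => (h s : ℂ)) volume 0 t :=
      ⟨(hI 0 t).1.ofReal, (hI 0 t).2.ofReal⟩
    exact this.const_mul _
  refine ⟨fun t _ => hi t, fun t ht => ?_⟩
  rw [integral_eq_sub_of_ae_hasDerivAt (hac t) (hi t)]
  · ring
  · filter_upwards [(hI 0 t).ae_hasDerivAt_integral] with x hx hxt
    have h1 := ((hx hxt 0 Set.left_mem_uIcc).ofReal_comp.mul_const Complex.I).cexp
    convert h1 using 1
    ring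

/-! ### Schrödinger solutions, componentwise -/

variable {H : ℝ → Matrix (Fin 2) (Fin 2) ℂ}

/-- Passing to components allows the scalar calculus of primitives; continuity need not be listed,
since primitives are continuous. -/
lemma isSchrodingerSolution_iff (hH : ∀ i j, LocallyIntegrable fun t => H t i j)
    {ψ : ℝ → Fin 2 → ℂ} :
    IsSchrodingerSolution H ψ ↔
      ∀ i, IsPrimitive (fun t => ψ t i) fun t => -Complex.I * (H t).mulVec (ψ t) i := by
  have key : ContinuousOn ψ (Set.Ici 0) → ∀ t, 0 ≤ t → ∀ i,
      IntervalIntegrable (fun s => (H s).mulVec (ψ s) i) volume 0 t := by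
    intro hc t ht i
    have hj : ∀ j, IntervalIntegrable (fun s => H s i j * ψ s j) volume 0 t := by
      intro j
      refine ((hH i j).integrableOn_isCompact isCompact_uIcc).intervalIntegrable.mul_continuousOn ?_
      rw [Set.uIcc_of_le ht]
      exact (continuousOn_pi.1 hc j).mono fun s hs => hs.1
    simpa only [Matrix.mulVec, dotProduct, Fin.sum_univ_two] using (hj 0).add (hj 1)
  have key2 : ContinuousOn ψ (Set.Ici 0) → ∀ t, 0 ≤ t → ∀ i,
      (∫ s in (0 : ℝ)..t, (H s).mulVec (ψ s)) i = ∫ s in (0 : ℝ)..t, (H s).mulVec (ψ s) i := by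
    intro hc t ht i
    have hv : IntervalIntegrable (fun s => (H s).mulVec (ψ s)) volume 0 t :=
      ⟨Integrable.of_eval fun i => (key hc t ht i).1, Integrable.of_eval fun i => (key hc t ht i).2⟩
    exact ((ContinuousLinearMap.proj (R := ℝ) (φ := fun _ : Fin 2 => ℂ)
      i).intervalIntegral_comp_comm hv).symm
  constructor
  · rintro ⟨hc, h⟩ i
    refine ⟨fun t ht => (key hc t ht i).const_mul _, fun t ht => ?_⟩
    have := congrFun (h t ht) i
    rw [Pi.sub_apply, Pi.smul_apply, key2 hc t ht] at this
    rw [this, intervalIntegral.integral_const_mul, smul_eq_mul]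
    ring
  · intro h
    have hc : ContinuousOn ψ (Set.Ici 0) := continuousOn_pi.2 fun i => (h i).continuousOn
    refine ⟨hc, fun t ht => funext fun i => ?_⟩
    rw [Pi.sub_apply, Pi.smul_apply, key2 hc t ht, (h i).eq_integral t ht,
      intervalIntegral.integral_const_mul, smul_eq_mul]
    ring

/-! ### Unitarity and uniqueness of the evolution -/

/-- Hermiticity cancels the two terms in the derivative of the inner product. -/
lemma IsSchrodingerSolution.inner_eq (hH : ∀ i j, LocallyIntegrable fun t => H t i j)
    (hherm : ∀ t, (H t).IsHermitian) {ψ χ : ℝ → Fin 2 → ℂ} (hψ : IsSchrodingerSolution H ψ)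
    (hχ : IsSchrodingerSolution H χ) {t : ℝ} (ht : 0 ≤ t) :
    star (ψ t) ⬝ᵥ χ t = star (ψ 0) ⬝ᵥ χ 0 := by
  rw [isSchrodingerSolution_iff hH] at hψ hχ
  have h := ((hψ 0).star.mul (hχ 0)).add ((hψ 1).star.mul (hχ 1))
  have h' := (h.congr (fun t _ => rfl) (g := fun _ => 0) fun t _ => by
    have h1 : star (H t 0 0) = H t 0 0 := (hherm t).apply 0 0
    have h2 : star (H t 0 1) = H t 1 0 := (hherm t).apply 1 0
    have h3 : star (H t 1 0) = H t 0 1 := (hherm t).apply 0 1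
    have h4 : star (H t 1 1) = H t 1 1 := (hherm t).apply 1 1
    simp [Matrix.mulVec, dotProduct, Fin.sum_univ_two] at *
    simp only [h1, h2, h3, h4]
    ring).eq_of_zero ht
  simpa [dotProduct, Fin.sum_univ_two] using h'

lemma IsSchrodingerSolution.linear_combination (hH : ∀ i j, LocallyIntegrable fun t => H t i j)
    {ψ χ : ℝ → Fin 2 → ℂ} (hψ : IsSchrodingerSolution H ψ) (hχ : IsSchrodingerSolution H χ)
    (a b : ℂ) : IsSchrodingerSolution H fun t => a • ψ t + b • χ t := by
  rw [isSchrodingerSolution_iff hH] at *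
  intro i
  refine (((hψ i).const_mul a).add ((hχ i).const_mul b)).congr (fun t _ => by simp) fun t _ => ?_
  simp only [Matrix.mulVec_add, Matrix.mulVec_smul, Pi.add_apply, Pi.smul_apply, smul_eq_mul]
  ring

lemma IsSchrodingerSolution.eq_of_initial (hH : ∀ i j, LocallyIntegrable fun t => H t i j)
    (hherm : ∀ t, (H t).IsHermitian) {ψ χ : ℝ → Fin 2 → ℂ} (hψ : IsSchrodingerSolution H ψ)
    (hχ : IsSchrodingerSolution H χ) (h0 : ψ 0 = χ 0) {t : ℝ} (ht : 0 ≤ t) : ψ t = χ t := by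
  -- The difference of the two solutions is a solution whose conserved norm starts at zero.
  have hd := hψ.linear_combination hH hχ 1 (-1)
  have h := hd.inner_eq hH hherm hd ht
  simp only [h0, one_smul, neg_smul, add_neg_cancel, dotProduct_zero] at h
  open scoped ComplexOrder in
  have := dotProduct_star_self_eq_zero.1 h
  exact add_neg_eq_zero.1 this

lemma IsEvolutionOperator.unique (hH : ∀ i j, LocallyIntegrable fun t => H t i j)
    (hherm : ∀ t, (H t).IsHermitian) {U U' : ℝ → Matrix (Fin 2) (Fin 2) ℂ}
    (hU : IsEvolutionOperator H U) (hU' : IsEvolutionOperator H U') {t : ℝ} (ht : 0 ≤ t) :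
    U t = U' t := by
  refine Matrix.ext_of_mulVec_single fun i => ?_
  exact (hU.2 (Pi.single i 1)).eq_of_initial hH hherm (hU'.2 _) (by simp only [hU.1, hU'.1]) ht

/-! ### The traceless part and the evolution operator -/

lemma locallyIntegrable_tracelessPart (hH : ∀ i j, LocallyIntegrable fun t => H t i j) (i j : Fin 2) :
    LocallyIntegrable fun t => tracelessPart H t i j := by
  have h : (fun t => tracelessPart H t i j) = fun t =>
      H t i j - (2⁻¹ * (1 : Matrix (Fin 2) (Fin 2) ℂ) i j) • (H t 0 0 + H t 1 1) := by
    funext t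
    simp only [tracelessPart, Matrix.sub_apply, Matrix.smul_apply, smul_eq_mul, Matrix.trace,
      Matrix.diag, Fin.sum_univ_two]
    ring
  rw [h]
  exact (hH i j).sub (((hH 0 0).add (hH 1 1)).smul (2⁻¹ * (1 : Matrix (Fin 2) (Fin 2) ℂ) i j))

/-- The state orthogonal to `v` obtained from it by the antiunitary time reversal. -/
def spinFlip (v : Fin 2 → ℂ) : Fin 2 → ℂ := ![-star (v 1), star (v 0)]

/-- The matrix with columns `v` and `spinFlip v`. -/
def frame (v : Fin 2 → ℂ) : Matrix (Fin 2) (Fin 2) ℂ := !![v 0, -star (v 1); v 1, star (v 0)]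

lemma trace_im_eq_zero {A : Matrix (Fin 2) (Fin 2) ℂ} (hA : A.IsHermitian) : A.trace.im = 0 := by
  have h : star A.trace = A.trace := by rw [← Matrix.trace_conjTranspose, hA.eq]
  exact Complex.conj_eq_iff_im.1 h

/-- Time reversal conjugates a traceless Hermitian matrix to its negative and, being antilinear,
also changes the sign of i. Hence it commutes with the generator. Vanishing trace is essential here.
-/
lemma IsSchrodingerSolution.spinFlip (hH : ∀ i j, LocallyIntegrable fun t => H t i j)
    (hherm : ∀ t, (H t).IsHermitian) {ψ : ℝ → Fin 2 → ℂ}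
    (hψ : IsSchrodingerSolution (tracelessPart H) ψ) :
    IsSchrodingerSolution (tracelessPart H) fun t => spinFlip (ψ t) := by
  rw [isSchrodingerSolution_iff (locallyIntegrable_tracelessPart hH)] at *
  have hh : ∀ t, star (H t 0 0) = H t 0 0 ∧ star (H t 0 1) = H t 1 0 ∧
      star (H t 1 0) = H t 0 1 ∧ star (H t 1 1) = H t 1 1 := fun t =>
    ⟨(hherm t).apply 0 0, (hherm t).apply 1 0, (hherm t).apply 0 1, (hherm t).apply 1 1⟩
  refine Fin.forall_fin_two.2 ⟨?_, ?_⟩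
  · refine ((hψ 1).star.const_mul (-1)).congr (fun t _ => by simp [QubitErgodicity.spinFlip])
      fun t _ => ?_
    obtain ⟨h1, h2, h3, h4⟩ := hh t
    simp [QubitErgodicity.spinFlip, tracelessPart, Matrix.mulVec, dotProduct, Fin.sum_univ_two,
      Matrix.trace] at *
    simp only [h1, h3, h4]
    ring
  · refine ((hψ 0).star).congr (fun t _ => by simp [QubitErgodicity.spinFlip])
      fun t _ => ?_
    obtain ⟨h1, h2, h3, h4⟩ := hh t
    simp [QubitErgodicity.spinFlip, tracelessPart, Matrix.mulVec, dotProduct, Fin.sum_univ_two,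
      Matrix.trace] at *
    simp only [h1, h2, h4]
    ring

/-- The global phase `exp(-i ∫₀ᵗ tr H / 2)`. -/
def globalPhase (H : ℝ → Matrix (Fin 2) (Fin 2) ℂ) (t : ℝ) : ℂ :=
  Complex.exp (((∫ s in (0 : ℝ)..t, -((H s).trace.re / 2) : ℝ) : ℂ) * Complex.I)

lemma norm_globalPhase (t : ℝ) : ‖globalPhase H t‖ = 1 := Complex.norm_exp_ofReal_mul_I _

lemma IsSchrodingerSolution.globalPhase_smul (hH : ∀ i j, LocallyIntegrable fun t => H t i j)
    (hherm : ∀ t, (H t).IsHermitian) {ψ : ℝ → Fin 2 → ℂ}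
    (hψ : IsSchrodingerSolution (tracelessPart H) ψ) :
    IsSchrodingerSolution H fun t => globalPhase H t • ψ t := by
  rw [isSchrodingerSolution_iff (locallyIntegrable_tracelessPart hH)] at hψ
  rw [isSchrodingerSolution_iff hH]
  have htr : LocallyIntegrable fun s => -((H s).trace.re / 2) := by
    have h := ((hH 0 0).add (hH 1 1)).smul (-2⁻¹ : ℂ)
    intro x
    obtain ⟨s, hs, hi⟩ := h x
    refine ⟨s, hs, ?_⟩
    have := hi.re
    refine this.congr (.of_forall fun t => ?_)
    simp [Matrix.trace]
    ring
  intro i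
  refine ((isPrimitive_exp htr).mul (hψ i)).congr (fun t _ => by simp [globalPhase]) fun t _ => ?_
  -- The phase was defined with the real part to make it visibly unimodular; nothing is lost, as the
  -- trace is real.
  have e : ((H t).trace.re : ℂ) = (H t).trace :=
    Complex.ext (by simp) (by simp [trace_im_eq_zero (hherm t)])
  simp only [tracelessPart, Matrix.sub_mulVec, Matrix.smul_mulVec, Matrix.one_mulVec,
    Matrix.mulVec_smul, Pi.sub_apply, Pi.smul_apply, smul_eq_mul, globalPhase]
  push_cast
  rw [e]
  ring

lemma frame_mem_unitaryGroup {v : Fin 2 → ℂ} (hv : star v ⬝ᵥ v = 1) :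
    frame v ∈ Matrix.unitaryGroup (Fin 2) ℂ := by
  rw [Matrix.mem_unitaryGroup_iff']
  simp only [dotProduct, Fin.sum_univ_two, Pi.star_apply, Complex.star_def] at hv
  ext i j
  fin_cases i <;> fin_cases j <;>
    simp [frame, Matrix.mul_apply, Fin.sum_univ_two, Matrix.star_apply]
  · exact hv
  · ring
  · ring
  · linear_combination hv

lemma frame_mulVec (v w : Fin 2 → ℂ) : (frame v).mulVec w = w 0 • v + w 1 • spinFlip v := by
  ext i
  fin_cases i <;> simp [frame, spinFlip, Matrix.mulVec, dotProduct, Fin.sum_univ_two] <;> ring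

/-- Any initial vector expands in the orthonormal basis given by the columns of `frame (ψ 0)`, and
the evolution of both columns is known. -/
lemma isEvolutionOperator_frame (hH : ∀ i j, LocallyIntegrable fun t => H t i j)
    (hherm : ∀ t, (H t).IsHermitian) {ψ : ℝ → Fin 2 → ℂ}
    (hψ : IsSchrodingerSolution (tracelessPart H) ψ) (h0 : star (ψ 0) ⬝ᵥ ψ 0 = 1) :
    IsEvolutionOperator H fun t => globalPhase H t • (frame (ψ t) * (frame (ψ 0)).conjTranspose) := by
  constructor
  · have h := Matrix.mem_unitaryGroup_iff.1 (frame_mem_unitaryGroup h0)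
    rw [Matrix.star_eq_conjTranspose] at h
    simp [h, globalPhase]
  · intro v
    have h := (hψ.globalPhase_smul hH hherm).linear_combination hH
      ((hψ.spinFlip hH hherm).globalPhase_smul hH hherm)
      ((frame (ψ 0)).conjTranspose.mulVec v 0) ((frame (ψ 0)).conjTranspose.mulVec v 1)
    convert h using 2 with t
    rw [Matrix.smul_mulVec, ← Matrix.mulVec_mulVec, frame_mulVec, smul_add, smul_comm,
      smul_comm (globalPhase H t)]

/-- The second column is antilinear in `v`, which is why the two columns acquire opposite
quasienergies. -/
lemma frame_smul (v : Fin 2 → ℂ) {z : ℂ} :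
    frame (z • v) = frame v * Matrix.diagonal ![z, star z] := by
  ext i j
  fin_cases i <;> fin_cases j <;> simp [frame, mul_comm]

/-! ### Time averages -/

lemma norm_timeAverage_le {f : ℝ → ℂ} {C T : ℝ} (hT : 0 < T) (hf : ∀ t, 0 ≤ t → ‖f t‖ ≤ C) :
    ‖timeAverage f T‖ ≤ C := by
  have h := intervalIntegral.norm_integral_le_of_norm_le_const (a := 0) (b := T) (f := f) (C := C)
    fun t ht => hf t (by rw [Set.uIoc_of_le hT.le] at ht; exact ht.1.le)
  rw [sub_zero, abs_of_pos hT] at h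
  rw [timeAverage, norm_mul, norm_inv, Complex.norm_real, Real.norm_of_nonneg hT.le,
    inv_mul_le_iff₀ hT, mul_comm]
  exact h

lemma norm_timeAverage_le_timeAverage {f : ℝ → ℂ} {g : ℝ → ℝ} {T : ℝ} (hT : 0 < T)
    (hg : ContinuousOn g (Set.Ici 0)) (hfg : ∀ t, 0 ≤ t → ‖f t‖ ≤ g t) :
    ‖timeAverage f T‖ ≤ ‖timeAverage (fun t => (g t : ℂ)) T‖ := by
  have hgi : IntervalIntegrable g volume 0 T := by
    refine (hg.mono ?_).intervalIntegrable
    rw [Set.uIcc_of_le hT.le]; exact fun s hs => hs.1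
  have h := intervalIntegral.norm_integral_le_of_norm_le hT.le (f := f)
    (ae_of_all _ fun t ht => hfg t ht.1.le) hgi
  rw [timeAverage, timeAverage, norm_mul, norm_mul, intervalIntegral.integral_ofReal,
    Complex.norm_real (∫ s in (0 : ℝ)..T, g s)]
  exact mul_le_mul_of_nonneg_left (h.trans (le_abs_self _)) (norm_nonneg _)

lemma timeAverage_add {f g : ℝ → ℂ} {T : ℝ} (hT : 0 ≤ T) (hf : ContinuousOn f (Set.Ici 0))
    (hg : ContinuousOn g (Set.Ici 0)) :
    timeAverage (fun t => f t + g t) T = timeAverage f T + timeAverage g T := by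
  have hs : Set.uIcc 0 T ⊆ Set.Ici (0 : ℝ) := by
    rw [Set.uIcc_of_le hT]; exact fun s hs => hs.1
  simp only [timeAverage]
  rw [intervalIntegral.integral_add (hf.mono hs).intervalIntegrable
    (hg.mono hs).intervalIntegrable, mul_add]

lemma timeAverage_const_mul (c : ℂ) (f : ℝ → ℂ) (T : ℝ) :
    timeAverage (fun t => c * f t) T = c * timeAverage f T := by
  simp only [timeAverage, intervalIntegral.integral_const_mul]
  ring

lemma timeAverage_congr {f g : ℝ → ℂ} {T : ℝ} (hT : 0 ≤ T) (h : ∀ t, 0 ≤ t → f t = g t) :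
    timeAverage f T = timeAverage g T := by
  simp only [timeAverage]
  congr 1
  refine intervalIntegral.integral_congr fun s hs => h s ?_
  rw [Set.uIcc_of_le hT] at hs
  exact hs.1

lemma tendsto_timeAverage_congr {f g : ℝ → ℂ} {l : Filter ℂ} (h : ∀ t, 0 ≤ t → f t = g t)
    (hf : Tendsto (timeAverage f) atTop l) : Tendsto (timeAverage g) atTop l := by
  refine hf.congr' ?_
  filter_upwards [eventually_ge_atTop 0] with T hT
  exact timeAverage_congr hT h

lemma tendsto_timeAverage_sum {ι : Type*} (s : Finset ι) {f : ι → ℝ → ℂ} {l : ι → ℂ}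
    (hf : ∀ i ∈ s, ContinuousOn (f i) (Set.Ici 0))
    (h : ∀ i ∈ s, Tendsto (timeAverage (f i)) atTop (𝓝 (l i))) :
    Tendsto (timeAverage fun t => ∑ i ∈ s, f i t) atTop (𝓝 (∑ i ∈ s, l i)) := by
  classical
  refine (tendsto_finsetSum s h).congr' ?_
  filter_upwards [eventually_ge_atTop 0] with T hT
  have hs : Set.uIcc 0 T ⊆ Set.Ici (0 : ℝ) := by
    rw [Set.uIcc_of_le hT]; exact fun s hs => hs.1
  simp only [timeAverage]
  rw [intervalIntegral.integral_finsetSum fun i hi => ((hf i hi).mono hs).intervalIntegrable,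
    Finset.mul_sum]

lemma tendsto_timeAverage_exp (ν : ℝ) :
    Tendsto (timeAverage fun t => Complex.exp (Complex.I * ν * t)) atTop
      (𝓝 (if ν = 0 then 1 else 0)) := by
  split_ifs with h
  · refine tendsto_const_nhds.congr' ?_
    filter_upwards [eventually_gt_atTop 0] with T hT
    have : (T : ℂ) ≠ 0 := by exact_mod_cast hT.ne'
    simp [timeAverage, h, this]
  · have hν : Complex.I * (ν : ℂ) ≠ 0 := by simp [h]
    rw [tendsto_zero_iff_norm_tendsto_zero]
    have h0 : Tendsto (fun T : ℝ => T⁻¹ * (2 / |ν|)) atTop (𝓝 0) := by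
      simpa using tendsto_inv_atTop_zero.mul_const (2 / |ν|)
    refine squeeze_zero' (.of_forall fun _ => norm_nonneg _) ?_ h0
    filter_upwards [eventually_gt_atTop 0] with T hT
    rw [timeAverage, integral_exp_mul_complex hν, norm_mul, norm_inv, Complex.norm_real,
      Real.norm_of_nonneg hT.le, norm_div]
    refine mul_le_mul_of_nonneg_left ?_ (by positivity)
    have e : ‖Complex.I * (ν : ℂ)‖ = |ν| := by simp
    rw [e]
    refine div_le_div_of_nonneg_right ((norm_sub_le _ _).trans ?_) (abs_nonneg _)
    have e1 : ∀ x : ℝ, ‖Complex.exp (Complex.I * ν * x)‖ = 1 := fun x => by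
      rw [show Complex.I * (ν : ℂ) * x = ((ν * x : ℝ) : ℂ) * Complex.I by push_cast; ring]
      exact Complex.norm_exp_ofReal_mul_I _
    rw [e1, e1]; norm_num

/-! ### Weyl's criterion with a weight, on a general compact space -/

section Equidistribution

variable {X : Type*} [TopologicalSpace X] [CompactSpace X] [MeasurableSpace X]
  [BorelSpace X] {μ : Measure X} [IsProbabilityMeasure μ] {γ : ℝ → X} {w : ℝ → ℂ} {c : ℂ}

/-- Both averages are linear and 1-Lipschitz for the sup norm, because the weight and `c` are
bounded by 1; so convergence passes from `s` to its closed span. It serves twice: with characters as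
weights on the torus, and with weight 1 on the space of channels. -/
lemma tendsto_timeAverage_of_dense (hγ : ContinuousOn γ (Set.Ici 0))
    (hw : ContinuousOn w (Set.Ici 0)) (hw1 : ∀ t, ‖w t‖ ≤ 1) (hc : ‖c‖ ≤ 1)
    {s : Set C(X, ℂ)} (hs : (Submodule.span ℂ s).topologicalClosure = ⊤)
    (h : ∀ g ∈ s, Tendsto (timeAverage fun t => w t * g (γ t)) atTop (𝓝 (c * ∫ x, g x ∂μ)))
    (g : C(X, ℂ)) :
    Tendsto (timeAverage fun t => w t * g (γ t)) atTop (𝓝 (c * ∫ x, g x ∂μ)) := by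
  have hcont : ∀ g : C(X, ℂ), ContinuousOn (fun t => w t * g (γ t)) (Set.Ici 0) := fun g =>
    hw.mul (g.continuous.comp_continuousOn hγ)
  have hint : ∀ g : C(X, ℂ), Integrable g μ := fun g =>
    g.continuous.integrable_of_hasCompactSupport (HasCompactSupport.of_compactSpace g)
  have hspan : ∀ g ∈ Submodule.span ℂ s,
      Tendsto (timeAverage fun t => w t * g (γ t)) atTop (𝓝 (c * ∫ x, g x ∂μ)) := by
    intro g hg
    induction hg using Submodule.span_induction with
    | mem g hg => exact h g hg
    | zero =>
      have : (timeAverage fun _ => (0 : ℂ)) = fun _ => 0 := by funext T; simp [timeAverage]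
      simp [this]
    | add f g _ _ hf hg =>
      simp only [ContinuousMap.add_apply]
      rw [integral_add (hint f) (hint g), mul_add]
      refine (hf.add hg).congr' ?_
      filter_upwards [eventually_ge_atTop 0] with T hT
      rw [← timeAverage_add hT (hcont f) (hcont g)]
      simp only [mul_add]
    | smul a g _ hg =>
      simp only [ContinuousMap.smul_apply, smul_eq_mul]
      rw [integral_const_mul, mul_left_comm]
      refine (hg.const_mul a).congr fun T => ?_
      rw [← timeAverage_const_mul]
      simp only [mul_left_comm]
  have hmem : g ∈ closure (Submodule.span ℂ s : Set C(X, ℂ)) := by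
    rw [← Submodule.topologicalClosure_coe, hs]; trivial
  rw [Metric.tendsto_nhds]
  intro ε hε
  obtain ⟨g', hg', hd⟩ := Metric.mem_closure_iff.1 hmem (ε / 3) (by positivity)
  filter_upwards [(Metric.tendsto_nhds.1 (hspan g' hg')) (ε / 3) (by positivity),
    eventually_gt_atTop 0] with T h1 hT
  have hpt : ∀ x, ‖g x - g' x‖ ≤ dist g g' := fun x => by
    rw [← dist_eq_norm]; exact ContinuousMap.dist_apply_le_dist x
  have h2 : dist (timeAverage (fun t => w t * g (γ t)) T)
      (timeAverage (fun t => w t * g' (γ t)) T) ≤ dist g g' := by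
    have e : timeAverage (fun t => w t * g (γ t)) T = timeAverage (fun t => w t * g' (γ t)) T
        + timeAverage (fun t => w t * (g - g') (γ t)) T := by
      rw [← timeAverage_add hT.le (hcont g') (hcont (g - g'))]
      congr 1; funext t; simp only [ContinuousMap.sub_apply]; ring
    rw [e, dist_eq_norm, add_sub_cancel_left]
    refine norm_timeAverage_le hT fun t _ => ?_
    rw [norm_mul, ContinuousMap.sub_apply]
    exact (mul_le_of_le_one_left (norm_nonneg _) (hw1 t)).trans (hpt _)
  have h3 : dist (c * ∫ x, g' x ∂μ) (c * ∫ x, g x ∂μ) ≤ dist g g' := by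
    rw [dist_comm, dist_eq_norm, ← mul_sub, ← integral_sub (hint g) (hint g'), norm_mul]
    refine (mul_le_of_le_one_left (norm_nonneg _) hc).trans ?_
    simpa using norm_integral_le_of_norm_le_const (μ := μ) (ae_of_all _ hpt)
  calc dist (timeAverage (fun t => w t * g (γ t)) T) (c * ∫ x, g x ∂μ)
      ≤ _ := dist_triangle4 _ (timeAverage (fun t => w t * g' (γ t)) T) (c * ∫ x, g' x ∂μ) _
    _ < ε := by linarith

end Equidistribution

/-- Cut off near the exceptional set: with χ equal to 1 on `N`, the function a(1 − χ) is continuous,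
while aχ is dominated by Cχ. The unweighted hypothesis `h1` controls the time average of χ by its
integral, which tends to μ(N) = 0 as the thickening shrinks. -/
lemma tendsto_timeAverage_of_continuousAt {X : Type*} [PseudoEMetricSpace X] [CompactSpace X]
    [MeasurableSpace X] [BorelSpace X] {μ : Measure X} [IsProbabilityMeasure μ] {γ : ℝ → X}
    {w : ℝ → ℂ} {c : ℂ} (hγ : ContinuousOn γ (Set.Ici 0))
    (hw : ContinuousOn w (Set.Ici 0)) (hw1 : ∀ t, ‖w t‖ ≤ 1) (hc : ‖c‖ ≤ 1)
    (h1 : ∀ g : C(X, ℂ), Tendsto (timeAverage fun t => g (γ t)) atTop (𝓝 (∫ x, g x ∂μ)))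
    (hcw : ∀ g : C(X, ℂ),
      Tendsto (timeAverage fun t => w t * g (γ t)) atTop (𝓝 (c * ∫ x, g x ∂μ)))
    {a : X → ℂ} {C : ℝ} (ha : ∀ x, ‖a x‖ ≤ C) {N : Set X} (hN : IsClosed N) (hμN : μ N = 0)
    (haN : ∀ x ∉ N, ContinuousAt a x) (haγ : ContinuousOn (fun t => a (γ t)) (Set.Ici 0)) :
    Tendsto (timeAverage fun t => w t * a (γ t)) atTop (𝓝 (c * ∫ x, a x ∂μ)) := by
  have hC : 0 ≤ C := (norm_nonneg _).trans (ha (γ 0))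
  let χ : ℕ → X → ℝ := fun n x =>
    thickenedIndicator (Nat.one_div_pos_of_nat (α := ℝ) (n := n)) N x
  have χc : ∀ n, Continuous (χ n) := fun n =>
    NNReal.continuous_coe.comp (thickenedIndicator _ N).continuous
  have χ0 : ∀ n x, 0 ≤ χ n x := fun n x => NNReal.coe_nonneg _
  have χ1 : ∀ n x, χ n x ≤ 1 := fun n x => by
    exact_mod_cast thickenedIndicator_le_one _ N x
  have χN : ∀ n, ∀ x ∈ N, χ n x = 1 := fun n x hx => by
    simp only [χ, thickenedIndicator_one _ N hx, NNReal.coe_one]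
  have hχ : Tendsto (fun n => ∫ x, (χ n x : ℂ) ∂μ) atTop (𝓝 0) := by
    have hlim := thickenedIndicator_tendsto_indicator_closure
      (fun n : ℕ => Nat.one_div_pos_of_nat (α := ℝ) (n := n))
      tendsto_one_div_add_atTop_nhds_zero_nat N
    rw [tendsto_pi_nhds] at hlim
    have h0 : (0 : ℂ) = ∫ x, (0 : ℂ) ∂μ := by simp
    rw [h0]
    refine tendsto_integral_of_dominated_convergence (fun _ => 1)
      (fun n => (Complex.continuous_ofReal.comp (χc n)).aestronglyMeasurable)
      (integrable_const _) (fun n => ae_of_all _ fun x => ?_) ?_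
    · rw [Complex.norm_real, Real.norm_of_nonneg (χ0 n x)]; exact χ1 n x
    · have : ∀ᵐ x ∂μ, x ∉ N := measure_eq_zero_iff_ae_notMem.1 hμN
      filter_upwards [this] with x hx
      have h := hlim x
      rw [hN.closure_eq, Set.indicator_of_notMem hx] at h
      have h' : Tendsto (fun n => (χ n x : ℂ)) atTop (𝓝 (((0 : NNReal) : ℝ) : ℂ)) :=
        ((Complex.continuous_ofReal.comp NNReal.continuous_coe).tendsto 0).comp h
      rwa [NNReal.coe_zero, Complex.ofReal_zero] at h'
  have hgc : ∀ n, Continuous fun x => a x * (1 - (χ n x : ℂ)) := by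
    intro n
    have hχc : Continuous fun x => (1 - (χ n x : ℂ)) := by fun_prop
    rw [continuous_iff_continuousAt]
    intro x
    by_cases hx : x ∈ N
    -- At points of `N` the factor 1 − χ tends to 0 and `a` is bounded, so discontinuities of `a`
    -- are harmless.
    · have e : a x * (1 - (χ n x : ℂ)) = 0 := by simp [χN n x hx]
      rw [ContinuousAt, e, tendsto_zero_iff_norm_tendsto_zero]
      have hz : Tendsto (fun y => C * ‖1 - (χ n y : ℂ)‖) (𝓝 x) (𝓝 0) := by
        have := (hχc.norm.tendsto x).const_mul C
        simpa [χN n x hx] using this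
      refine squeeze_zero (fun _ => norm_nonneg _) (fun y => ?_) hz
      rw [norm_mul]
      exact mul_le_mul_of_nonneg_right (ha y) (norm_nonneg _)
    · exact (haN x hx).mul hχc.continuousAt
  have ham : AEStronglyMeasurable a μ := by
    have : μ.restrict Nᶜ = μ := Measure.restrict_eq_self_of_ae_mem
      (measure_eq_zero_iff_ae_notMem.1 hμN)
    rw [← this]
    exact ContinuousOn.aestronglyMeasurable_of_isSeparable
      (fun x hx => (haN x hx).continuousWithinAt) hN.measurableSet.compl
      (TopologicalSpace.IsSeparable.of_separableSpace _)
  have hai : Integrable a μ := .of_bound ham C (ae_of_all _ ha)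
  rw [Metric.tendsto_nhds]
  intro ε hε
  -- The cutoff is fixed before the time goes to infinity. Three errors below ε/4 occur: the
  -- continuous part, the time average near `N`, and the integral near `N`.
  obtain ⟨n, hn⟩ : ∃ n, C * ‖∫ x, (χ n x : ℂ) ∂μ‖ < ε / 4 := by
    have := (hχ.norm.const_mul C)
    rw [norm_zero, mul_zero] at this
    exact (this.eventually (gt_mem_nhds (by positivity))).exists
  have hA := Metric.tendsto_nhds.1 (hcw ⟨_, hgc n⟩) (ε / 4) (by positivity)
  have hB := ((h1 ⟨fun x => (χ n x : ℂ), by fun_prop⟩).norm.const_mul C).eventually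
    (gt_mem_nhds hn)
  filter_upwards [hA, hB, eventually_gt_atTop 0] with T hA hB hT
  simp only [ContinuousMap.coe_mk] at hA hB
  have e : timeAverage (fun t => w t * a (γ t)) T =
      timeAverage (fun t => w t * (a (γ t) * (1 - (χ n (γ t) : ℂ)))) T
        + timeAverage (fun t => w t * (a (γ t) * (χ n (γ t) : ℂ))) T := by
    refine Eq.trans ?_ (timeAverage_add hT.le
      (f := fun t => w t * (a (γ t) * (1 - (χ n (γ t) : ℂ))))
      (g := fun t => w t * (a (γ t) * (χ n (γ t) : ℂ)))
      (hw.mul ((hgc n).comp_continuousOn hγ))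
      (hw.mul (haγ.mul ((Complex.continuous_ofReal.comp (χc n)).comp_continuousOn hγ))))
    congr 1; funext t; ring
  have hrest : ‖timeAverage (fun t => w t * (a (γ t) * (χ n (γ t) : ℂ))) T‖ < ε / 4 := by
    refine lt_of_le_of_lt ?_ hB
    have := norm_timeAverage_le_timeAverage (f := fun t => w t * (a (γ t) * (χ n (γ t) : ℂ)))
      (g := fun t => C * χ n (γ t)) hT (((χc n).comp_continuousOn hγ).const_smul C) (fun t _ => by
        rw [norm_mul, norm_mul, Complex.norm_real, Real.norm_of_nonneg (χ0 n _)]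
        exact (mul_le_of_le_one_left (mul_nonneg (norm_nonneg _) (χ0 n _)) (hw1 t)).trans
          (mul_le_mul_of_nonneg_right (ha _) (χ0 n _)))
    refine this.trans (le_of_eq ?_)
    simp only [Complex.ofReal_mul]
    rw [timeAverage_const_mul, norm_mul, Complex.norm_real, Real.norm_of_nonneg hC]
  have hint : ‖c * ∫ x, a x * (1 - (χ n x : ℂ)) ∂μ - c * ∫ x, a x ∂μ‖ < ε / 4 := by
    refine lt_of_le_of_lt ?_ hn
    have hgi : Integrable (fun x => a x * (1 - (χ n x : ℂ))) μ :=
      (hgc n).integrable_of_hasCompactSupport (HasCompactSupport.of_compactSpace _)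
    rw [← mul_sub, ← integral_sub hgi hai, norm_mul]
    refine (mul_le_of_le_one_left (norm_nonneg _) hc).trans ?_
    rw [integral_complex_ofReal, Complex.norm_real, Real.norm_of_nonneg (integral_nonneg (χ0 n)),
      ← integral_const_mul]
    refine norm_integral_le_of_norm_le ?_ (ae_of_all _ fun x => ?_)
    · exact (((χc n).integrable_of_hasCompactSupport
        (HasCompactSupport.of_compactSpace _))).const_mul C
    · rw [show a x * (1 - (χ n x : ℂ)) - a x = -(a x * (χ n x : ℂ)) by ring, norm_neg, norm_mul,
        Complex.norm_real, Real.norm_of_nonneg (χ0 n x)]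
      exact mul_le_mul_of_nonneg_right (ha x) (χ0 n x)
  rw [dist_eq_norm] at hA ⊢
  rw [e]
  calc _ = ‖(timeAverage (fun t => w t * (a (γ t) * (1 - (χ n (γ t) : ℂ)))) T -
          c * ∫ x, a x * (1 - (χ n x : ℂ)) ∂μ) +
        timeAverage (fun t => w t * (a (γ t) * (χ n (γ t) : ℂ))) T +
        (c * ∫ x, a x * (1 - (χ n x : ℂ)) ∂μ - c * ∫ x, a x ∂μ)‖ := by congr 1; ring
    _ ≤ _ := norm_add₃_le
    _ < ε := by linarith

/-! ### Equidistribution of linear flows on the torus -/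

variable {m : ℕ}

/-- The Haar probability measure on `(ℝ / ℤ)^m`. -/
def torusMeasure (m : ℕ) : Measure (UnitAddTorus (Fin m)) :=
  Measure.pi fun _ => AddCircle.haarAddCircle

instance : IsProbabilityMeasure (torusMeasure m) := by
  unfold torusMeasure; infer_instance

/-- The covering map `ℝ^m → (ℝ / ℤ)^m`. -/
def torusProj (x : Fin m → ℝ) : UnitAddTorus (Fin m) := fun j => (x j : UnitAddCircle)

lemma isOpenQuotientMap_torusProj : IsOpenQuotientMap (torusProj (m := m)) :=
  IsOpenQuotientMap.piMap fun _ => QuotientAddGroup.isOpenQuotientMap_mk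

lemma integral_torusMeasure (f : UnitAddTorus (Fin m) → ℂ) :
    ∫ x, f x ∂(torusMeasure m) =
      ∫ x in Set.univ.pi (fun _ : Fin m => Set.Ioc (0 : ℝ) 1), f (torusProj x) := by
  have h := UnitAddTorus.integral_preimage f 0
  refine h.trans ?_
  congr 2
  ext x
  simp [Set.mem_pi]

lemma torusMeasure_eq_zero {N : Set (UnitAddTorus (Fin m))} (hN : MeasurableSet N)
    (h : volume (torusProj ⁻¹' N) = 0) : torusMeasure m N = 0 := by
  have h1 := UnitAddTorus.lintegral_preimage (N.indicator fun _ => (1 : ENNReal)) (0 : Fin m → ℝ)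
  have h2 : torusMeasure m N = ∫⁻ x, N.indicator (fun _ => (1 : ENNReal)) x ∂(torusMeasure m) := by
    rw [lintegral_indicator hN]; simp
  rw [h2]
  refine h1.trans ?_
  refine (lintegral_congr_ae (g := fun _ => 0) (ae_restrict_of_ae ?_)).trans lintegral_zero
  filter_upwards [measure_eq_zero_iff_ae_notMem.1 h] with x hx
  exact Set.indicator_of_notMem (f := fun _ => (1 : ENNReal)) hx

lemma integral_mFourier (n : Fin m → ℤ) :
    ∫ x, UnitAddTorus.mFourier n x ∂(torusMeasure m) = if n = 0 then 1 else 0 := by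
  split_ifs with h
  · simp [h, UnitAddTorus.mFourier_zero]
  · obtain ⟨i, hi⟩ := Function.ne_iff.1 h
    simp only [UnitAddTorus.mFourier, ContinuousMap.coe_mk, torusMeasure]
    rw [integral_fintype_prod_eq_prod]
    refine Finset.prod_eq_zero (Finset.mem_univ i) ?_
    have := orthonormal_iff_ite.1 (orthonormal_fourier (T := 1)) 0 (n i)
    rw [ContinuousMap.inner_toLp, if_neg fun h' => hi h'.symm] at this
    simpa using this

lemma mFourier_torusProj (n : Fin m → ℤ) (x : Fin m → ℝ) :
    UnitAddTorus.mFourier n (torusProj x) =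
      Complex.exp (2 * Real.pi * Complex.I * ((∑ j, (n j : ℝ) * x j : ℝ) : ℂ)) := by
  simp only [UnitAddTorus.mFourier, ContinuousMap.coe_mk, torusProj, fourier_coe_apply]
  rw [← Complex.exp_sum]
  congr 1
  push_cast
  rw [Finset.mul_sum]
  refine Finset.sum_congr rfl fun j _ => ?_
  ring

lemma torusPeriodic_eq_of_torusProj_eq {E : Type*} {a : (Fin m → ℝ) → E} (ha : TorusPeriodic a)
    {x y : Fin m → ℝ} (h : torusProj x = torusProj y) :
    a ((2 * Real.pi) • x) = a ((2 * Real.pi) • y) := by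
  have h1 : ∀ j, ∃ k : ℤ, x j - y j = k := fun j => by
    have := congrFun h j
    simp only [torusProj] at this
    rw [← sub_eq_zero, ← AddCircle.coe_sub, AddCircle.coe_eq_zero_iff] at this
    obtain ⟨k, hk⟩ := this
    exact ⟨k, by simpa using hk.symm⟩
  choose k hk using h1
  rw [← ha ((2 * Real.pi) • y) k]
  congr 1
  funext j
  simp only [Pi.smul_apply, smul_eq_mul, ← hk]
  ring

open Pointwise in
lemma torusAverage_eq (a : (Fin m → ℝ) → ℂ) :
    torusAverage a = ∫ x in Set.univ.pi (fun _ : Fin m => Set.Ioc (0 : ℝ) 1),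
      a ((2 * Real.pi) • x) := by
  have hpi : (0 : ℝ) < 2 * Real.pi := by positivity
  rw [Measure.setIntegral_comp_smul volume a _ hpi.ne', torusAverage]
  have hset : (2 * Real.pi) • Set.univ.pi (fun _ : Fin m => Set.Ioc (0 : ℝ) 1) =
      Set.univ.pi (fun _ : Fin m => Set.Ioc (0 : ℝ) (2 * Real.pi)) := by
    ext x
    rw [Set.mem_smul_set_iff_inv_smul_mem₀ hpi.ne']
    simp only [Set.mem_univ_pi, Pi.smul_apply, smul_eq_mul, Set.mem_Ioc]
    refine forall_congr' fun j => ?_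
    rw [inv_mul_le_iff₀ hpi, mul_one]
    refine and_congr_left fun _ => ?_
    constructor
    · intro h; exact (mul_pos_iff_of_pos_left (inv_pos.2 hpi)).1 h
    · intro h; positivity
  rw [hset]
  have hae : (Set.univ.pi (fun _ : Fin m => Set.Ico (0 : ℝ) (2 * Real.pi))) =ᵐ[volume]
      Set.univ.pi (fun _ : Fin m => Set.Ioc (0 : ℝ) (2 * Real.pi)) :=
    Measure.univ_pi_Ico_ae_eq_Icc.trans Measure.univ_pi_Ioc_ae_eq_Icc.symm
  rw [setIntegral_congr_set hae, abs_of_pos (by positivity), Module.finrank_fin_fun,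
    Complex.real_smul, Complex.ofReal_inv]

lemma continuous_torusProj : Continuous (torusProj (m := m)) :=
  isOpenQuotientMap_torusProj.continuous

lemma RationallyIndependent.sum_eq_zero_iff {ω : Fin m → ℝ} {q : ℝ}
    (hq : RationallyIndependent (Fin.cons q ω : Fin (m + 1) → ℝ)) (n : ℤ) (k : Fin m → ℤ) :
    (n : ℝ) * q + ∑ j, (k j : ℝ) * ω j = 0 ↔ n = 0 ∧ k = 0 := by
  constructor
  · intro h
    have := hq (Fin.cons n k) (by simpa [Fin.sum_univ_succ] using h)
    constructor
    · simpa using congrFun this 0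
    · funext j
      simpa using congrFun this j.succ
  · rintro ⟨rfl, rfl⟩; simp

/-- On the Fourier monomial of index k the integrand is a pure exponential of frequency nq + k·ω,
which is zero only for n = 0 and k = 0. The factor (2π)⁻¹ converts angles to coordinates of period
1. -/
theorem tendsto_timeAverage_torusProj {ω : Fin m → ℝ} {q : ℝ}
    (hq : RationallyIndependent (Fin.cons q ω : Fin (m + 1) → ℝ)) (n : ℤ)
    (g : C(UnitAddTorus (Fin m), ℂ)) :
    Tendsto (timeAverage fun t => Complex.exp (Complex.I * ((n * q : ℝ) : ℂ) * t) *
        g (torusProj (t • ((2 * Real.pi)⁻¹ • ω)))) atTop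
      (𝓝 ((if n = 0 then 1 else 0) * ∫ x, g x ∂(torusMeasure m))) := by
  refine tendsto_timeAverage_of_dense (s := Set.range UnitAddTorus.mFourier)
    (γ := fun t : ℝ => torusProj (t • ((2 * Real.pi)⁻¹ • ω)))
    ((continuous_torusProj.comp (by fun_prop)).continuousOn) (by fun_prop)
    (fun t => ?_) (by split_ifs <;> simp) UnitAddTorus.span_mFourier_closure_eq_top ?_ g
  · rw [show Complex.I * ((n * q : ℝ) : ℂ) * t = ((n * q * t : ℝ) : ℂ) * Complex.I by
      push_cast; ring, Complex.norm_exp_ofReal_mul_I]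
  · rintro _ ⟨k, rfl⟩
    have h := tendsto_timeAverage_exp (n * q + ∑ j, (k j : ℝ) * ω j)
    have e : (if (n : ℝ) * q + ∑ j, (k j : ℝ) * ω j = 0 then (1 : ℂ) else 0) =
        (if n = 0 then 1 else 0) * ∫ x, UnitAddTorus.mFourier k x ∂(torusMeasure m) := by
      rw [integral_mFourier]
      simp only [hq.sum_eq_zero_iff n k]
      split_ifs <;> simp_all
    rw [e] at h
    refine h.congr fun T => ?_
    congr 1
    funext t
    rw [mFourier_torusProj, ← Complex.exp_add]
    congr 1
    have hpi : (Real.pi : ℂ) ≠ 0 := by exact_mod_cast Real.pi_ne_zero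
    have : (∑ j, (k j : ℝ) * (t • ((2 * Real.pi)⁻¹ • ω)) j) =
        t * (2 * Real.pi)⁻¹ * ∑ j, (k j : ℝ) * ω j := by
      rw [Finset.mul_sum]
      refine Finset.sum_congr rfl fun j _ => ?_
      simp only [Pi.smul_apply, smul_eq_mul]
      ring
    rw [this]
    push_cast
    field_simp

/-- Weyl equidistribution along a linear flow, for bounded functions on the torus which are
continuous on an open set of full measure, twisted by a character. -/
theorem tendsto_timeAverage_torus {ω : Fin m → ℝ} {q : ℝ}
    (hq : RationallyIndependent (Fin.cons q ω : Fin (m + 1) → ℝ)) (n : ℤ)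
    {a : (Fin m → ℝ) → ℂ} (hper : TorusPeriodic a) {C : ℝ} (hC : ∀ θ, ‖a θ‖ ≤ C)
    {S : Set (Fin m → ℝ)} (hS : IsOpen S) (hSnull : volume Sᶜ = 0) (haS : ContinuousOn a S)
    (haω : ContinuousOn (fun t : ℝ => a (t • ω)) (Set.Ici 0)) :
    Tendsto (timeAverage fun t => Complex.exp (Complex.I * ((n * q : ℝ) : ℂ) * t) * a (t • ω))
      atTop (𝓝 ((if n = 0 then 1 else 0) * torusAverage a)) := by
  have hpi : (2 * Real.pi : ℝ) ≠ 0 := by positivity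
  have hsurj := (isOpenQuotientMap_torusProj (m := m)).surjective
  -- Descent of `a` to the unit torus; the arbitrary section does not matter, by periodicity.
  set b : UnitAddTorus (Fin m) → ℂ := fun y => a ((2 * Real.pi) • Function.surjInv hsurj y) with hb
  have hbp : ∀ x, b (torusProj x) = a ((2 * Real.pi) • x) := fun x =>
    torusPeriodic_eq_of_torusProj_eq hper (Function.surjInv_eq hsurj _)
  have hbω : ∀ t : ℝ, b (torusProj (t • ((2 * Real.pi)⁻¹ • ω))) = a (t • ω) := fun t => by
    rw [hbp, smul_comm t, smul_inv_smul₀ hpi]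
  set S' : Set (Fin m → ℝ) := (fun x => (2 * Real.pi) • x) ⁻¹' S with hS'
  have hS'o : IsOpen S' := hS.preimage (continuous_const_smul _)
  -- The set `S` need not be periodic: since the projection is an open quotient map, continuity at a
  -- single lift of a point suffices.
  set N : Set (UnitAddTorus (Fin m)) := (torusProj '' S')ᶜ with hN
  have hNc : IsClosed N := (isOpenQuotientMap_torusProj.isOpenMap _ hS'o).isClosed_compl
  have hN0 : torusMeasure m N = 0 := by
    refine torusMeasure_eq_zero hNc.measurableSet ?_
    refine measure_mono_null (t := (fun x => (2 * Real.pi) • x) ⁻¹' Sᶜ) (fun x hx hxS => ?_) ?_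
    · exact hx ⟨x, hxS, rfl⟩
    · rw [Measure.addHaar_preimage_smul volume hpi, hSnull, mul_zero]
  have hcont : ∀ y ∉ N, ContinuousAt b y := by
    intro y hy
    obtain ⟨x, hx, rfl⟩ := not_not.1 hy
    rw [← isOpenQuotientMap_torusProj.continuousAt_comp_iff]
    have : b ∘ torusProj = fun x => a ((2 * Real.pi) • x) := funext hbp
    rw [this]
    exact ContinuousAt.comp (f := fun x : Fin m → ℝ => (2 * Real.pi) • x)
      (haS.continuousAt (hS.mem_nhds hx)) (continuous_const_smul _).continuousAt
  have hI : ∫ y, b y ∂(torusMeasure m) = torusAverage a := by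
    rw [integral_torusMeasure, torusAverage_eq]
    simp only [hbp]
  have key := tendsto_timeAverage_of_continuousAt (μ := torusMeasure m)
    (w := fun t => Complex.exp (Complex.I * ((n * q : ℝ) : ℂ) * t))
    (c := if n = 0 then 1 else 0)
    (γ := fun t : ℝ => torusProj (t • ((2 * Real.pi)⁻¹ • ω)))
    ((continuous_torusProj.comp (by fun_prop)).continuousOn) (by fun_prop) (fun t => by
      rw [show Complex.I * ((n * q : ℝ) : ℂ) * t = ((n * q * t : ℝ) : ℂ) * Complex.I by
        push_cast; ring, Complex.norm_exp_ofReal_mul_I]) (by split_ifs <;> simp)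
    (fun g => by simpa using tendsto_timeAverage_torusProj hq 0 g)
    (tendsto_timeAverage_torusProj hq n) (a := b) (fun x => hC _) hNc hN0 hcont
    (by simpa only [hbω] using haω)
  simpa only [hbω, hI] using key

/-! ### Haar measure on `U(2)` -/

instance : haarU2.IsHaarMeasure := by unfold haarU2; infer_instance

instance : IsProbabilityMeasure haarU2 :=
  ⟨by simpa [haarU2] using Measure.haarMeasure_self (K₀ := (⊤ : TopologicalSpace.PositiveCompacts U2))⟩

/-- A right translate of Haar measure is again a Haar probability measure, hence the same one. -/
instance : haarU2.IsMulRightInvariant where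
  map_mul_right_eq_self g := by
    have h1 : (haarU2.map (· * g)).IsHaarMeasure := Measure.isHaarMeasure_map_mul_right haarU2 g
    have h2 : IsProbabilityMeasure (haarU2.map (· * g)) :=
      Measure.isProbabilityMeasure_map (measurable_mul_const g).aemeasurable
    exact Measure.isHaarMeasure_eq_of_isProbabilityMeasure _ _

lemma integrable_haarU2 {f : U2 → ℂ} (hf : Continuous f) : Integrable f haarU2 :=
  hf.integrable_of_hasCompactSupport (HasCompactSupport.of_compactSpace f)

/-! ### Tensor powers -/

variable {n : Type*} {k : ℕ}

lemma tensorPower_apply (A : Matrix n n ℂ) (i j : Fin k → n) :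
    tensorPower k A i j = ∏ l, A (i l) (j l) := rfl

lemma tensorPower_mul [Fintype n] [DecidableEq n] (A B : Matrix n n ℂ) :
    tensorPower k (A * B) = tensorPower k A * tensorPower k B := by
  ext i j
  simp only [tensorPower_apply, Matrix.mul_apply, Finset.prod_univ_sum, Fintype.piFinset_univ,
    Finset.prod_mul_distrib]

lemma tensorPower_diagonal [DecidableEq n] (d : n → ℂ) :
    tensorPower k (Matrix.diagonal d) = Matrix.diagonal fun i : Fin k → n => ∏ l, d (i l) := by
  ext i j
  rw [tensorPower_apply]
  by_cases h : i = j
  · subst h; simp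
  · obtain ⟨l, hl⟩ := Function.ne_iff.1 h
    rw [Matrix.diagonal_apply_ne _ h]
    exact Finset.prod_eq_zero (Finset.mem_univ l) (Matrix.diagonal_apply_ne _ hl)

lemma continuous_tensorPower_apply (i j : Fin k → n) :
    Continuous fun A : Matrix n n ℂ => tensorPower k A i j := by
  simp only [tensorPower_apply]
  exact continuous_finsetProd _ fun l _ => continuous_apply_apply _ _

/-! ### The vectorized channel -/

lemma channel_mul (A B : Matrix (Fin 2) (Fin 2) ℂ) :
    channel (A * B) = channel A * channel B := by
  have h : (A * B).map star = A.map star * B.map star :=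
    Matrix.map_mul (f := starRingEnd ℂ)
  rw [channel, h, channel, channel, Matrix.mul_kronecker_mul]

lemma channel_smul {z : ℂ} (hz : ‖z‖ = 1) (A : Matrix (Fin 2) (Fin 2) ℂ) :
    channel (z • A) = channel A := by
  have h : star z * z = 1 := by
    rw [Complex.star_def, mul_comm, Complex.mul_conj, Complex.normSq_eq_norm_sq, hz]; simp
  ext i j
  simp only [channel, Matrix.kroneckerMap_apply, Matrix.map_apply, Matrix.smul_apply, smul_eq_mul,
    star_mul']
  linear_combination (star (A i.1 j.1) * A i.2 j.2) * h

lemma channel_diagonal (d : Fin 2 → ℂ) :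
    channel (Matrix.diagonal d) = Matrix.diagonal fun p : Fin 2 × Fin 2 => star (d p.1) * d p.2 := by
  have h : (Matrix.diagonal d).map star = Matrix.diagonal fun i => star (d i) :=
    Matrix.diagonal_map (star_zero ℂ)
  rw [channel, h, Matrix.diagonal_kronecker_diagonal]

lemma continuous_channel : Continuous (channel : Matrix (Fin 2) (Fin 2) ℂ → _) := by
  refine continuous_matrix fun i j => ?_
  simp only [channel, Matrix.kroneckerMap_apply, Matrix.map_apply]
  exact (continuous_apply_apply _ _).star.mul (continuous_apply_apply _ _)

lemma tensorPower_channel_apply (A : Matrix (Fin 2) (Fin 2) ℂ) (i l : Fin k → Fin 2 × Fin 2) :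
    tensorPower k (channel A) i l =
      (∏ p, star (A (i p).1 (l p).1)) * ∏ p, A (i p).2 (l p).2 := by
  simp only [tensorPower_apply, channel, Matrix.kroneckerMap_apply, Matrix.map_apply,
    Finset.prod_mul_distrib]

/-- The charge `+1` of the first and `-1` of the second basis vector under `diag(e^{-iφ}, e^{iφ})`. -/
def spinCharge (a : Fin 2) : ℤ := if a = 0 then 1 else -1

/-- The charge of a column of `(V^* ⊗ V)^{⊗k}`. -/
def tensorCharge (l : Fin k → Fin 2 × Fin 2) : ℤ :=
  ∑ p, (spinCharge (l p).1 - spinCharge (l p).2)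

/-- The matrix `diag(e^{-iφ}, e^{iφ})`. -/
def phaseMatrix (φ : ℝ) : Matrix (Fin 2) (Fin 2) ℂ :=
  Matrix.diagonal fun a => Complex.exp (-(spinCharge a * φ : ℝ) * Complex.I)

lemma tensorPower_channel_phaseMatrix (φ : ℝ) :
    tensorPower k (channel (phaseMatrix φ)) =
      Matrix.diagonal fun l => Complex.exp ((tensorCharge l * φ : ℝ) * Complex.I) := by
  rw [phaseMatrix, channel_diagonal, tensorPower_diagonal]
  congr 1
  funext l
  simp only [Complex.star_def, ← Complex.exp_conj, map_mul, map_neg, Complex.conj_ofReal,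
    Complex.conj_I, ← Complex.exp_add]
  rw [← Complex.exp_sum]
  congr 1
  rw [tensorCharge]
  push_cast
  rw [Finset.sum_mul, Finset.sum_mul]
  refine Finset.sum_congr rfl fun p _ => ?_
  ring

lemma phaseMatrix_mem_unitaryGroup (φ : ℝ) : phaseMatrix φ ∈ Matrix.unitaryGroup (Fin 2) ℂ := by
  rw [Matrix.mem_unitaryGroup_iff, Matrix.star_eq_conjTranspose, phaseMatrix,
    Matrix.diagonal_conjTranspose, Matrix.diagonal_mul_diagonal, ← Matrix.diagonal_one]
  congr 1
  funext a
  rw [Pi.star_apply, Complex.star_def, Complex.mul_conj, Complex.normSq_eq_norm_sq]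
  simp [Complex.norm_exp]

lemma sum_spinCharge (f : Fin k → Fin 2) :
    ∑ p, spinCharge (f p) = 2 * (Fintype.card {p // f p = 0} : ℤ) - k := by
  have h : ∀ p, spinCharge (f p) = 2 * (if f p = 0 then 1 else 0) - 1 := fun p => by
    unfold spinCharge; split_ifs <;> norm_num
  simp only [h, Finset.sum_sub_distrib, ← Finset.mul_sum, Finset.sum_boole, Fintype.card_subtype]
  simp

/-- The total charge determines how often each index value occurs, so the fibres of `f` and `g` can
be matched bijectively. -/
lemma exists_perm_of_sum_spinCharge_eq {f g : Fin k → Fin 2}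
    (h : ∑ p, spinCharge (f p) = ∑ p, spinCharge (g p)) :
    ∃ σ : Equiv.Perm (Fin k), ∀ p, g (σ p) = f p := by
  rw [sum_spinCharge, sum_spinCharge] at h
  have h0 : Fintype.card {p // f p = 0} = Fintype.card {p // g p = 0} := by omega
  have h1 : ∀ c, Fintype.card {p // f p = c} = Fintype.card {p // g p = c} := by
    refine Fin.forall_fin_two.2 ⟨h0, ?_⟩
    have e : ∀ f : Fin k → Fin 2,
        Fintype.card {p // f p = 1} = k - Fintype.card {p // f p = 0} := fun f => by
      have := Fintype.card_subtype_compl fun p => f p = 0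
      rw [Fintype.card_fin] at this
      rw [← this]
      exact Fintype.card_congr (Equiv.subtypeEquivRight fun p => by
        have := Fin.exists_fin_two.1 ⟨f p, rfl⟩
        omega)
    rw [e, e, h0]
  exact ⟨Equiv.ofFiberEquiv fun c => Fintype.equivOfCardEq (h1 c), Equiv.ofFiberEquiv_map _⟩

lemma conj_refState_apply (V : Matrix (Fin 2) (Fin 2) ℂ) (a b : Fin 2) :
    (V * refState * V.conjTranspose) a b = V a 0 * star (V b 0) := by
  simp [refState, projector, Matrix.mul_apply, Fin.sum_univ_two, Matrix.vecMulVec]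

/-- On unitary matrices, the charge-zero entries of `(V^* ⊗ V)^{⊗k}` are linear functions of
`(V φ₀ V†)^{⊗k}`. -/
lemma exists_coeff_tensorPower_channel (i l : Fin k → Fin 2 × Fin 2) (hl : tensorCharge l = 0) :
    ∃ C : (Fin k → Fin 2 × Fin 2) → ℂ, ∀ V ∈ Matrix.unitaryGroup (Fin 2) ℂ,
      tensorPower k (channel V) i l =
        ∑ x, C x * tensorPower k (V * refState * V.conjTranspose) (fun p => (x p).1)
          (fun p => (x p).2) := by
  -- Zero charge pairs each conjugated entry with an unconjugated entry from the same column of `V`.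
  obtain ⟨σ, hσ⟩ := exists_perm_of_sum_spinCharge_eq (f := fun p => (l p).1)
    (g := fun p => (l p).2) (by
      rw [tensorCharge, Finset.sum_sub_distrib] at hl; linarith)
  -- For column 0 the pair is an entry of V φ₀ V†. For column 1, orthonormality of the rows makes it
  -- δ minus such an entry; δ is multiplied by the trace of V φ₀ V†, which is 1, so that each factor
  -- is homogeneous of degree one and the product has degree exactly k.
  let d : Fin k → Fin 2 × Fin 2 → ℂ := fun p x =>
    if (l p).1 = 0 then (if x = ((i (σ p)).2, (i p).1) then 1 else 0)
    else (if x.1 = x.2 ∧ (i (σ p)).2 = (i p).1 then 1 else 0) -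
      (if x = ((i (σ p)).2, (i p).1) then 1 else 0)
  refine ⟨fun x => ∏ p, d p (x p), fun V hV => ?_⟩
  have hrow : ∀ a b, V a 0 * star (V b 0) + V a 1 * star (V b 1) = if a = b then 1 else 0 :=
    fun a b => by
      have := congrFun (congrFun (Matrix.mem_unitaryGroup_iff.1 hV) a) b
      rwa [Matrix.mul_apply, Fin.sum_univ_two, Matrix.one_apply] at this
  have hcol : V 0 0 * star (V 0 0) + V 1 0 * star (V 1 0) = 1 := by
    have := congrFun (congrFun (Matrix.mem_unitaryGroup_iff'.1 hV) 0) 0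
    rw [Matrix.mul_apply, Fin.sum_univ_two, Matrix.one_apply, if_pos rfl] at this
    rw [← this]
    simp only [Matrix.star_apply]
    ring
  have hfac : ∀ p, star (V (i p).1 (l p).1) * V (i (σ p)).2 (l p).1 =
      ∑ x : Fin 2 × Fin 2, d p x * (V * refState * V.conjTranspose) x.1 x.2 := by
    intro p
    simp only [conj_refState_apply, d]
    split_ifs with h0
    · simp [h0, mul_comm]
    · have h1 : (l p).1 = 1 := by omega
      simp only [sub_mul, Finset.sum_sub_distrib, ite_mul, one_mul, zero_mul, Finset.sum_ite_eq',
        Finset.mem_univ, if_true]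
      have hd : (∑ x : Fin 2 × Fin 2, if x.1 = x.2 ∧ (i (σ p)).2 = (i p).1 then
          V x.1 0 * star (V x.2 0) else 0) = if (i (σ p)).2 = (i p).1 then 1 else 0 := by
        by_cases h2 : (i (σ p)).2 = (i p).1
        · simp only [h2, and_true, if_true]
          rw [← hcol]; simp [Fintype.sum_prod_type, Fin.sum_univ_two]
        · simp [h2]
      rw [hd, ← hrow, h1]
      ring
  rw [tensorPower_channel_apply, ← Equiv.prod_comp σ fun p => V (i p).2 (l p).2,
    ← Finset.prod_mul_distrib]
  simp only [hσ, hfac, Finset.prod_univ_sum, Fintype.piFinset_univ, Finset.prod_mul_distrib,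
    tensorPower_apply]

/-! ### Haar moments of the channel -/

lemma continuous_channel_moment (i j : Fin k → Fin 2 × Fin 2) :
    Continuous fun V : U2 => tensorPower k (channel V.1) i j :=
  (continuous_tensorPower_apply i j).comp (continuous_channel.comp continuous_subtype_val)

/-- Right invariance of Haar measure together with multiplicativity of the tensor power. -/
lemma haarUnitaryMoment_mul (R : U2) :
    haarUnitaryMoment k * tensorPower k (channel R.1) = haarUnitaryMoment k := by
  ext i j
  simp only [Matrix.mul_apply, haarUnitaryMoment, Matrix.of_apply]
  rw [← integral_mul_right_eq_self (fun V : U2 => tensorPower k (channel V.1) i j) R]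
  simp only [Submonoid.coe_mul, channel_mul, tensorPower_mul, Matrix.mul_apply]
  rw [integral_finsetSum _ fun l _ => (integrable_haarU2 (continuous_channel_moment i l)).mul_const _]
  simp only [integral_mul_const]

lemma haarUnitaryMoment_apply_eq_zero (i l : Fin k → Fin 2 × Fin 2) (hl : tensorCharge l ≠ 0) :
    haarUnitaryMoment k i l = 0 := by
  have hl' : (tensorCharge l : ℝ) ≠ 0 := by exact_mod_cast hl
  -- The angle π/charge makes the diagonal phase act on column `l` as −1, so the entry equals its
  -- own negative.
  have h := congrFun (congrFun (haarUnitaryMoment_mul (k := k)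
    ⟨phaseMatrix (Real.pi / tensorCharge l), phaseMatrix_mem_unitaryGroup _⟩) i) l
  simp only [tensorPower_channel_phaseMatrix, Matrix.mul_diagonal] at h
  rw [mul_div_cancel₀ _ hl', Complex.exp_pi_mul_I] at h
  linear_combination (-1 / 2 : ℂ) * h

/-! ### Functions of the eigenstate on the torus -/

lemma projector_eq_frame (v : Fin 2 → ℂ) :
    projector v = frame v * refState * (frame v).conjTranspose := by
  ext i j
  rw [conj_refState_apply]
  fin_cases i <;> fin_cases j <;> simp [projector, frame, Matrix.vecMulVec]

lemma continuous_frame : Continuous frame := by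
  refine continuous_matrix fun i j => ?_
  fin_cases i <;> fin_cases j <;> simp [frame] <;> fun_prop

lemma continuous_channel_frame (i j : Fin k → Fin 2 × Fin 2) :
    Continuous fun v => tensorPower k (channel (frame v)) i j :=
  (continuous_tensorPower_apply i j).comp (continuous_channel.comp continuous_frame)

lemma continuous_tensorPower_projector (i j : Fin k → Fin 2) :
    Continuous fun v => tensorPower k (projector v) i j := by
  refine (continuous_tensorPower_apply i j).comp (continuous_matrix fun i j => ?_)
  simp only [projector, Matrix.vecMulVec_apply]
  fun_prop

lemma norm_apply_le_one_of_unit {v : Fin 2 → ℂ} (hv : star v ⬝ᵥ v = 1) (i : Fin 2) :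
    ‖v i‖ ≤ 1 := by
  have := entry_norm_bound_of_unitary (frame_mem_unitaryGroup hv) i 0
  fin_cases i <;> simpa [frame] using this

lemma exists_bound_of_unit {f : (Fin 2 → ℂ) → ℂ} (hf : Continuous f) :
    ∃ C, ∀ v : Fin 2 → ℂ, star v ⬝ᵥ v = 1 → ‖f v‖ ≤ C := by
  obtain ⟨C, hC⟩ := (isCompact_univ_pi fun _ : Fin 2 =>
    isCompact_closedBall (0 : ℂ) 1).exists_bound_of_continuousOn hf.continuousOn
  exact ⟨C, fun v hv => hC v fun i _ => by simpa using norm_apply_le_one_of_unit hv i⟩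

/-- A piecewise smooth function is continuous on an open set of full measure. -/
lemma exists_continuousOn_of_piecewiseSmooth {α : (Fin m → ℝ) → Fin 2 → ℂ}
    (hα : ∀ i, PiecewiseSmooth fun θ => α θ i) :
    ∃ S : Set (Fin m → ℝ), IsOpen S ∧ volume Sᶜ = 0 ∧ ContinuousOn α S := by
  choose P hPo _ hPn hPs using hα
  refine ⟨⋂ i, ⋃ n, P i n, isOpen_iInter_of_finite fun i => isOpen_iUnion (hPo i), ?_, ?_⟩
  · rw [Set.compl_iInter]
    exact measure_iUnion_null hPn
  · refine continuousOn_pi.2 fun i θ hθ => ContinuousAt.continuousWithinAt ?_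
    obtain ⟨n, hn⟩ := Set.mem_iUnion.1 (Set.mem_iInter.1 hθ i)
    exact (hPs i n).continuousOn.continuousAt ((hPo i n).mem_nhds hn)

/-! ### The evolution written through the eigenstate, and its moments -/

section Eigenstate

variable {ω : Fin m → ℝ} {q : ℝ} {α : (Fin m → ℝ) → Fin 2 → ℂ}

/-- Although `α` may jump on the torus, along the orbit it is a continuous phase times a continuous
solution. -/
lemma IsQuasienergyEigenstate.continuousOn_flow (hα : IsQuasienergyEigenstate ω H q α) :
    ContinuousOn (fun t : ℝ => α (t • ω)) (Set.Ici 0) := by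
  have he : Continuous fun t : ℝ => Complex.exp (Complex.I * q * t) := by fun_prop
  have h : ContinuousOn (fun t : ℝ => Complex.exp (Complex.I * q * t) •
      (Complex.exp (-(Complex.I * (q : ℂ) * (t : ℂ))) • α (t • ω))) (Set.Ici 0) :=
    he.continuousOn.smul hα.solution.1
  refine h.congr fun t _ => ?_
  simp only [smul_smul, ← Complex.exp_add, add_neg_cancel, Complex.exp_zero, one_smul]

/-- Twisted equidistribution for continuous functions of the eigenstate. -/
lemma IsQuasienergyEigenstate.tendsto_timeAverage (hα : IsQuasienergyEigenstate ω H q α)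
    (hq : RationallyIndependent (Fin.cons q ω : Fin (m + 1) → ℝ)) (n : ℤ)
    {f : (Fin 2 → ℂ) → ℂ} (hf : Continuous f) :
    Tendsto (timeAverage fun t => Complex.exp (Complex.I * ((n * q : ℝ) : ℂ) * t) * f (α (t • ω)))
      atTop (𝓝 ((if n = 0 then 1 else 0) * torusAverage fun θ => f (α θ))) := by
  obtain ⟨S, hSo, hSn, hS⟩ := exists_continuousOn_of_piecewiseSmooth hα.piecewiseSmooth
  obtain ⟨C, hC⟩ := exists_bound_of_unit hf
  exact tendsto_timeAverage_torus hq n (a := fun θ => f (α θ))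
    (fun θ k => congrArg f (hα.periodic θ k)) (fun θ => hC _ (hα.normalized θ)) hSo hSn
    (hf.comp_continuousOn hS) (hf.comp_continuousOn hα.continuousOn_flow)

lemma IsQuasienergyEigenstate.integrableOn (hα : IsQuasienergyEigenstate ω H q α)
    {f : (Fin 2 → ℂ) → ℂ} (hf : Continuous f) :
    IntegrableOn (fun θ => f (α θ))
      (Set.univ.pi fun _ : Fin m => Set.Ico (0 : ℝ) (2 * Real.pi)) := by
  obtain ⟨S, hSo, hSn, hS⟩ := exists_continuousOn_of_piecewiseSmooth hα.piecewiseSmooth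
  obtain ⟨C, hC⟩ := exists_bound_of_unit hf
  have hm : AEStronglyMeasurable (fun θ => f (α θ)) volume := by
    have : (volume : Measure (Fin m → ℝ)).restrict S = volume :=
      Measure.restrict_eq_self_of_ae_mem
        (by simpa using measure_eq_zero_iff_ae_notMem.1 hSn)
    rw [← this]
    exact (hf.comp_continuousOn hS).aestronglyMeasurable hSo.measurableSet
  refine Measure.integrableOn_of_bounded (M := C) ?_ hm (ae_of_all _ fun θ => hC _ (hα.normalized θ))
  rw [volume_pi_pi]
  exact (ENNReal.prod_lt_top fun _ _ => by rw [Real.volume_Ico]; exact ENNReal.ofReal_lt_top).ne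

lemma IsQuasienergyEigenstate.torusAverage_sum (hα : IsQuasienergyEigenstate ω H q α)
    {ι : Type*} (s : Finset ι) (c : ι → ℂ) {f : ι → (Fin 2 → ℂ) → ℂ} (hf : ∀ x, Continuous (f x)) :
    torusAverage (fun θ => ∑ x ∈ s, c x * f x (α θ)) =
      ∑ x ∈ s, c x * torusAverage fun θ => f x (α θ) := by
  simp only [torusAverage]
  rw [integral_finsetSum _ fun x _ => (hα.integrableOn (hf x)).const_mul _, Finset.mul_sum]
  refine Finset.sum_congr rfl fun x _ => ?_
  rw [integral_const_mul]
  ring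

/-- The same coefficients express the channel entry through the state for every unitary, so the
identity can be averaged both over the frames of `α` and over Haar measure; k-HSE equates the
results. -/
lemma IsQuasienergyEigenstate.torusAverage_channel (hα : IsQuasienergyEigenstate ω H q α)
    (hk : TorusKHSE k α) (i l : Fin k → Fin 2 × Fin 2) (hl : tensorCharge l = 0) :
    torusAverage (fun θ => tensorPower k (channel (frame (α θ))) i l) =
      haarUnitaryMoment k i l := by
  obtain ⟨C, hC⟩ := exists_coeff_tensorPower_channel i l hl
  have h1 : (fun θ => tensorPower k (channel (frame (α θ))) i l) = fun θ =>
      ∑ x, C x * tensorPower k (projector (α θ)) (fun p => (x p).1) (fun p => (x p).2) := by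
    funext θ
    rw [hC _ (frame_mem_unitaryGroup (hα.normalized θ)), ← projector_eq_frame]
  rw [h1, hα.torusAverage_sum Finset.univ C
    fun x => continuous_tensorPower_projector (fun p => (x p).1) (fun p => (x p).2)]
  have h2 : haarUnitaryMoment k i l =
      ∑ x, C x * haarStateMoment k (fun p => (x p).1) (fun p => (x p).2) := by
    simp only [haarUnitaryMoment, haarStateMoment, Matrix.of_apply]
    rw [integral_congr_ae (ae_of_all _ fun V : U2 => hC V.1 V.2), integral_finsetSum]
    · simp only [integral_const_mul]
    · intro x _
      refine (integrable_haarU2 ?_).const_mul _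
      refine (continuous_tensorPower_apply _ _).comp ?_
      have : Continuous fun V : U2 => V.1 := continuous_subtype_val
      exact (this.matrix_mul continuous_const).matrix_mul this.matrix_conjTranspose
  rw [h2]
  refine Finset.sum_congr rfl fun x _ => ?_
  rw [← hk]
  rfl

lemma frame_phase (t : ℝ) (v : Fin 2 → ℂ) :
    frame (Complex.exp (-(Complex.I * (q : ℂ) * (t : ℂ))) • v) = frame v * phaseMatrix (q * t) := by
  rw [frame_smul, phaseMatrix]
  congr 2
  funext a
  fin_cases a
  · simp [spinCharge]; congr 1; ring
  · simp [spinCharge, ← Complex.exp_conj]; congr 1; ring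

/-- The evolution operator, up to a phase, in terms of the quasienergy eigenstate. -/
def eigenstateEvolution (ω : Fin m → ℝ) (q : ℝ) (α : (Fin m → ℝ) → Fin 2 → ℂ) (t : ℝ) :
    Matrix (Fin 2) (Fin 2) ℂ :=
  frame (α (t • ω)) * phaseMatrix (q * t) * (frame (α 0)).conjTranspose

lemma IsQuasienergyEigenstate.eigenstateEvolution_mem (hα : IsQuasienergyEigenstate ω H q α)
    (t : ℝ) : eigenstateEvolution ω q α t ∈ Matrix.unitaryGroup (Fin 2) ℂ :=
  mul_mem (mul_mem (frame_mem_unitaryGroup (hα.normalized _)) (phaseMatrix_mem_unitaryGroup _))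
    (Unitary.star_mem (frame_mem_unitaryGroup (hα.normalized _)))

lemma continuous_phaseMatrix : Continuous phaseMatrix := by
  refine Continuous.matrix_diagonal (continuous_pi fun a => ?_)
  fun_prop

lemma IsQuasienergyEigenstate.continuousOn_eigenstateEvolution
    (hα : IsQuasienergyEigenstate ω H q α) :
    ContinuousOn (eigenstateEvolution ω q α) (Set.Ici 0) := by
  have h1 := continuous_frame.comp_continuousOn hα.continuousOn_flow
  have h2 : Continuous fun t => phaseMatrix (q * t) := continuous_phaseMatrix.comp (by fun_prop)
  exact (h1.mul h2.continuousOn).mul continuousOn_const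

lemma IsQuasienergyEigenstate.isEvolutionOperator
    (hα : IsQuasienergyEigenstate ω (tracelessPart H) q α)
    (hH : ∀ i j, LocallyIntegrable fun t => H t i j) (hherm : ∀ t, (H t).IsHermitian) :
    IsEvolutionOperator H fun t => globalPhase H t • eigenstateEvolution ω q α t := by
  have h := isEvolutionOperator_frame hH hherm hα.solution
    (by simpa using hα.normalized 0)
  simpa only [frame_phase, eigenstateEvolution, Complex.ofReal_zero, mul_zero, neg_zero,
    Complex.exp_zero, one_smul, zero_smul] using h

lemma IsQuasienergyEigenstate.evolutionKUE (hα : IsQuasienergyEigenstate ω H q α)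
    (hq : RationallyIndependent (Fin.cons q ω : Fin (m + 1) → ℝ)) (hk : TorusKHSE k α) :
    EvolutionKUE k (eigenstateEvolution ω q α) := by
  refine tendsto_pi_nhds.2 fun i => tendsto_pi_nhds.2 fun j => ?_
  let R : U2 := ⟨_, Unitary.star_mem (frame_mem_unitaryGroup (hα.normalized 0))⟩
  set c : (Fin k → Fin 2 × Fin 2) → ℂ := fun l => tensorPower k (channel R.1) l j
  -- The Haar moment is expanded with the same constant right factor as the evolution, so that the
  -- limits can be compared column by column.
  have hM : haarUnitaryMoment k i j = ∑ l, c l * haarUnitaryMoment k i l := by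
    conv_lhs => rw [← haarUnitaryMoment_mul R, Matrix.mul_apply]
    exact Finset.sum_congr rfl fun l _ => mul_comm _ _
  have hU : ∀ t, tensorPower k (channel (eigenstateEvolution ω q α t)) i j =
      ∑ l, Complex.exp (Complex.I * ((tensorCharge l * q : ℝ) : ℂ) * t) *
        (c l * tensorPower k (channel (frame (α (t • ω)))) i l) := by
    intro t
    rw [eigenstateEvolution, channel_mul, channel_mul, tensorPower_mul, tensorPower_mul,
      tensorPower_channel_phaseMatrix, Matrix.mul_apply]
    refine Finset.sum_congr rfl fun l _ => ?_
    rw [Matrix.mul_diagonal, show Complex.I * ((tensorCharge l * q : ℝ) : ℂ) * t =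
      ((tensorCharge l * (q * t) : ℝ) : ℂ) * Complex.I by push_cast; ring]
    simp only [c, R, Matrix.star_eq_conjTranspose]
    ring
  have hlim : ∀ l : Fin k → Fin 2 × Fin 2, Tendsto (timeAverage fun t =>
      Complex.exp (Complex.I * ((tensorCharge l * q : ℝ) : ℂ) * t) *
        (c l * tensorPower k (channel (frame (α (t • ω)))) i l)) atTop
      (𝓝 (c l * haarUnitaryMoment k i l)) := by
    intro l
    have h := (hα.tendsto_timeAverage hq (tensorCharge l)
      (continuous_channel_frame i l)).const_mul (c l)
    have e : (if tensorCharge l = 0 then (1 : ℂ) else 0) *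
        torusAverage (fun θ => tensorPower k (channel (frame (α θ))) i l) =
        haarUnitaryMoment k i l := by
      split_ifs with hl
      · rw [one_mul, hα.torusAverage_channel hk i l hl]
      · rw [zero_mul, haarUnitaryMoment_apply_eq_zero i l hl]
    rw [e] at h
    refine h.congr fun T => ?_
    rw [← timeAverage_const_mul]
    congr 1; funext t; ring
  have hcont : ∀ l : Fin k → Fin 2 × Fin 2, ContinuousOn (fun t : ℝ =>
      Complex.exp (Complex.I * ((tensorCharge l * q : ℝ) : ℂ) * t) *
        (c l * tensorPower k (channel (frame (α (t • ω)))) i l)) (Set.Ici 0) := fun l =>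
    ContinuousOn.mul (by fun_prop) (continuousOn_const.mul
      ((continuous_channel_frame i l).comp_continuousOn hα.continuousOn_flow))
  have := tendsto_timeAverage_sum Finset.univ (fun l _ => hcont l) (fun l _ => hlim l)
  simp only [Matrix.of_apply, hU, hM]
  exact this

/-! ### From all moments to the full distribution -/

/-- The compact set of unitary channels. -/
abbrev ChannelSpace : Type := Set.range fun V : U2 => channel V.1

instance : CompactSpace ChannelSpace :=
  isCompact_iff_compactSpace.1 (isCompact_range (continuous_channel.comp continuous_subtype_val))

instance : MeasurableSpace ChannelSpace := borel _
instance : BorelSpace ChannelSpace := ⟨rfl⟩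

/-- The channel of a unitary, as a point of the space of channels. -/
def toChannelSpace (V : U2) : ChannelSpace := ⟨channel V.1, V, rfl⟩

lemma continuous_toChannelSpace : Continuous toChannelSpace :=
  (continuous_channel.comp continuous_subtype_val).subtype_mk _

/-- The matrix entries of `(V^* ⊗ V)^{⊗k}`, as functions on the space of channels. -/
def channelMonomial (x : Σ k : ℕ, (Fin k → Fin 2 × Fin 2) × (Fin k → Fin 2 × Fin 2)) :
    C(ChannelSpace, ℂ) :=
  ⟨fun A => tensorPower x.1 A.1 x.2.1 x.2.2,
    (continuous_tensorPower_apply _ _).comp continuous_subtype_val⟩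

/-- Concatenating index tuples multiplies entries of two tensor powers into an entry of a higher
one. -/
lemma channelMonomial_mul (x y) : ∃ z, channelMonomial x * channelMonomial y = channelMonomial z := by
  obtain ⟨k, i, j⟩ := x
  obtain ⟨k', i', j'⟩ := y
  refine ⟨⟨k + k', Fin.append i i', Fin.append j j'⟩, ?_⟩
  ext A
  simp [channelMonomial, tensorPower_apply, Fin.prod_univ_add]

/-- Conjugating an entry of V* ⊗ V amounts to swapping the two tensor factors; this makes the span
self-adjoint. -/
lemma channelMonomial_star (x) : ∃ z, star (channelMonomial x) = channelMonomial z := by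
  obtain ⟨k, i, j⟩ := x
  refine ⟨⟨k, fun p => (i p).swap, fun p => (j p).swap⟩, ?_⟩
  ext ⟨A, V, rfl⟩
  change star (∏ p, channel V.1 (i p) (j p)) = ∏ p, channel V.1 (i p).swap (j p).swap
  rw [star_prod]
  simp [channel, mul_comm]

/-- The span of the monomials, as a star subalgebra. -/
def channelSubalgebra : StarSubalgebra ℂ C(ChannelSpace, ℂ) where
  toSubalgebra := (Submodule.span ℂ (Set.range channelMonomial)).toSubalgebra
    (Submodule.subset_span ⟨⟨0, Fin.elim0, Fin.elim0⟩, by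
      ext A; simp [channelMonomial, tensorPower_apply]⟩)
    (fun f g hf hg => by
      have h := Submodule.mul_mem_mul hf hg
      rw [Submodule.span_mul_span] at h
      refine Submodule.span_mono ?_ h
      rintro _ ⟨_, ⟨x, rfl⟩, _, ⟨y, rfl⟩, rfl⟩
      obtain ⟨z, hz⟩ := channelMonomial_mul x y
      exact ⟨z, hz.symm⟩)
  star_mem' := by
    intro f hf
    change f ∈ Submodule.span ℂ (Set.range channelMonomial) at hf
    change star f ∈ Submodule.span ℂ (Set.range channelMonomial)
    induction hf using Submodule.span_induction with
    | mem f hf =>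
      obtain ⟨x, rfl⟩ := hf
      obtain ⟨z, hz⟩ := channelMonomial_star x
      exact Submodule.subset_span ⟨z, hz.symm⟩
    | zero => simp
    | add f g _ _ hf hg => rw [star_add]; exact add_mem hf hg
    | smul c f _ hf => rw [star_smul]; exact Submodule.smul_mem _ _ hf

/-- Stone–Weierstrass: monomials of degree one are the matrix entries and already separate points.
-/
lemma span_channelMonomial_closure_eq_top :
    (Submodule.span ℂ (Set.range channelMonomial)).topologicalClosure = ⊤ := by
  have h := ContinuousMap.starSubalgebra_topologicalClosure_eq_top_of_separatesPoints
    channelSubalgebra (by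
      intro A B hAB
      have : ∃ i j, A.1 i j ≠ B.1 i j := by
        by_contra! h
        exact hAB (Subtype.ext (Matrix.ext h))
      obtain ⟨i, j, hij⟩ := this
      refine ⟨_, ⟨channelMonomial ⟨1, fun _ => i, fun _ => j⟩, Submodule.subset_span ⟨_, rfl⟩, rfl⟩,
        ?_⟩
      simpa [channelMonomial, tensorPower_apply] using hij)
  exact congr_arg (Subalgebra.toSubmodule <| StarSubalgebra.toSubalgebra ·) h

lemma evolutionCUE_of_evolutionKUE {U : ℝ → Matrix (Fin 2) (Fin 2) ℂ}
    (hU : ∀ t, U t ∈ Matrix.unitaryGroup (Fin 2) ℂ) (hUc : ContinuousOn U (Set.Ici 0))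
    (h : ∀ k, EvolutionKUE k U) : EvolutionCUE U := by
  intro f hf
  let μ : Measure ChannelSpace := haarU2.map toChannelSpace
  have : IsProbabilityMeasure μ :=
    Measure.isProbabilityMeasure_map continuous_toChannelSpace.measurable.aemeasurable
  have hint : ∀ g : C(ChannelSpace, ℂ), ∫ A, g A ∂μ = ∫ V : U2, g (toChannelSpace V) ∂haarU2 :=
    fun g => integral_map continuous_toChannelSpace.measurable.aemeasurable
      (g.continuous.measurable.aestronglyMeasurable)
  -- The moment limits are the convergence hypothesis on the dense span, against the pushforward of
  -- Haar measure.
  have key := tendsto_timeAverage_of_dense (μ := μ) (w := fun _ => 1) (c := 1)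
    (γ := fun t => toChannelSpace ⟨U t, hU t⟩)
    (continuous_toChannelSpace.comp_continuousOn (continuousOn_iff_continuous_domRestrict.2
      ((continuousOn_iff_continuous_domRestrict.1 hUc).subtype_mk _)))
    continuousOn_const (by simp) (by simp) span_channelMonomial_closure_eq_top (by
      rintro _ ⟨⟨k, i, j⟩, rfl⟩
      have := tendsto_pi_nhds.1 (tendsto_pi_nhds.1 (h k) i) j
      simp only [one_mul, hint]
      exact this) ⟨fun A => f A.1, hf.comp continuous_subtype_val⟩
  simp only [one_mul, hint] at key
  exact key

lemma TorusCHSE.torusKHSE (h : TorusCHSE α) (k : ℕ) : TorusKHSE k α := by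
  ext i j
  exact h (fun A => tensorPower k A i j) (continuous_tensorPower_apply i j)

lemma EvolutionKUE.congr_channel {U U' : ℝ → Matrix (Fin 2) (Fin 2) ℂ}
    (hUU' : ∀ t, 0 ≤ t → channel (U t) = channel (U' t)) (h : EvolutionKUE k U) :
    EvolutionKUE k U' := by
  refine tendsto_pi_nhds.2 fun i => tendsto_pi_nhds.2 fun j => ?_
  exact tendsto_timeAverage_congr (fun t ht => by rw [hUU' t ht])
    (tendsto_pi_nhds.1 (tendsto_pi_nhds.1 h i) j)

lemma EvolutionCUE.congr_channel {U U' : ℝ → Matrix (Fin 2) (Fin 2) ℂ}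
    (hUU' : ∀ t, 0 ≤ t → channel (U t) = channel (U' t)) (h : EvolutionCUE U) :
    EvolutionCUE U' := fun f hf =>
  tendsto_timeAverage_congr (fun t ht => by rw [hUU' t ht]) (h f hf)

end Eigenstate

end QubitErgodicity

end

theorem corollaryG1 {m : ℕ} (ω : Fin m → ℝ) (H : ℝ → Matrix (Fin 2) (Fin 2) ℂ)
    (hH : QubitErgodicity.IsQuasiperiodicHamiltonian ω H)
    (q : ℝ) (α : (Fin m → ℝ) → Fin 2 → ℂ)
    (hα : QubitErgodicity.IsQuasienergyEigenstate ω (QubitErgodicity.tracelessPart H) q α)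
    (hq : QubitErgodicity.RationallyIndependent (Fin.cons q ω : Fin (m + 1) → ℝ)) :
    (∀ k : ℕ, QubitErgodicity.TorusKHSE k α → QubitErgodicity.SatisfiesKUE k H) ∧
      (QubitErgodicity.TorusCHSE α → QubitErgodicity.SatisfiesCUE H) := by
  have hev := hα.isEvolutionOperator hH.locallyIntegrable hH.isHermitian
  -- By uniqueness every evolution operator is the explicit one for nonnegative times, and its
  -- global phase cancels in the channel.
  have hch : ∀ U, QubitErgodicity.IsEvolutionOperator H U → ∀ t, 0 ≤ t →
      QubitErgodicity.channel (QubitErgodicity.eigenstateEvolution ω q α t) =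
        QubitErgodicity.channel (U t) := fun U hU t ht => by
    rw [hU.unique hH.locallyIntegrable hH.isHermitian hev ht,
      QubitErgodicity.channel_smul (QubitErgodicity.norm_globalPhase t)]
  refine ⟨fun k hk => ⟨⟨_, hev⟩, fun U hU => ?_⟩, fun hc => ⟨⟨_, hev⟩, fun U hU => ?_⟩⟩
  · exact (hα.evolutionKUE hq hk).congr_channel (hch U hU)
  · exact (QubitErgodicity.evolutionCUE_of_evolutionKUE hα.eigenstateEvolution_mem
      hα.continuousOn_eigenstateEvolution
      fun k => hα.evolutionKUE hq (hc.torusKHSE k)).congr_channel (hch U hU)
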